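/- **Setting.** Let $\mathcal X,\mathcal Y,\Theta$ be (real or complex) Hilbert spaces, $T>0$, $A$ a skew-adjoint operator in $\mathcal X$ ($A^*=-A$, densely defined, possibly unbounded) generating the strongly continuous group $(e^{At})_{t\in\mathbb R}$, $C\in\mathcal L(\mathcal X,\mathcal Y)$, $B\in L^2(0,T;\mathcal L(\Theta,\mathcal X))$, and let $U_0\in\mathcal L(\Theta)$ be self-adjoint with $U_0\ge\delta I$ for some $\delta>0$. Assume exact observability: for some $\gamma>0$, $$\int_0^T\|Ce^{At}x\|_{\mathcal Y}^2\,dt\ \ge\ \gamma^2\|x\|_{\mathcal X}^2\qquad\text{for all }x\in\mathcal X .$$ Let $\kappa>0$ be a constant gain, $y\in L^2(0,T;\mathcal Y)$ and $\theta_0\in\Theta$. For $\zeta\in\mathcal X$, $\xi\in\Theta$ let $\hat z[\zeta,\xi]$ be the mild solution on $[0,T]$ of $$\dot{\hat z}=A\hat z+B\xi+\kappa C^*(y-C\hat z),\qquad \hat z(0)=\zeta ,$$ and let $$J(\xi,\zeta)=\langle \xi-\theta_0,U_0(\xi-\theta_0)\rangle+\int_0^T\|y-C\hat z[\zeta,\xi]\|_{\mathcal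 Y}^2\,dt .$$ One iteration of the method (back and forth nudging with a Gauss–Newton step) takes estimates $(\zeta,\hat\theta)\in\mathcal X\times\Theta$ to new estimates $(\zeta',\hat\theta')$ as follows. On $[0,T]$ solve $$\hat z^+=\hat z[\zeta,\hat\theta],\qquad \dot\Pi=(A-\kappa C^*C)\Pi+B,\ \Pi(0)=0,$$ $$\dot U=\Pi^*C^*C\Pi,\ U(0)=U_0,\qquad \dot\eta=\Pi^*C^*(y-C\hat z^+),\ \eta(0)=0,$$ where the equation for $\Pi$ is understood in the mild sense, strongly on $\Theta$, and those for $U$ and $\eta$ in the integrated, weak sense on $\Theta$; put $$\hat\theta'=\hat\theta-U(T)^{-1}\big(U_0(\hat\theta-\theta_0)-\eta(T)\big);$$ then solve (mild solution on $[0,T]$) $$\dot{\hat z}^-(t)=-A\hat z^-(t)+\kappa C^*\big(y(T-t)-C\hat z^-(t)\big)-B(T-t)\hat\theta',\qquad \hat z^-(0)=\hat z^+(T)+\Pi(T)(\hat\theta'-\hat\theta),$$ and put $\zeta'=\hat z^-(T)$. **Theorem.** For every $\kappa>0$, $y\in L^2(0,T;\mathcal Y)$ and $\theta_0\in\Theta$,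 the iteration is well defined, $\zeta'$ does not depend on $\hat\theta$, so that $\zeta'=f(\zeta)$ for a map $f:\mathcal X\to\mathcal X$, the cost $J$ has a unique minimizer $(\theta^o,\zeta^o)$, and $f(\zeta^o)=\zeta^o$. Let $g(\zeta)=f(\zeta+\zeta^o)-\zeta^o$ and $$\alpha=\min\left(\frac{\delta\gamma^2}{T^2\|C\|_{\mathcal L(\mathcal X,\mathcal Y)}^2\|B\|_{L^2(0,T;\mathcal L(\Theta,\mathcal X))}^2},\ \gamma^2\right),$$ where the quotient is read as $+\infty$ if its denominator vanishes. Then there are constants $M\in\mathbb R$ and $\kappa_0>0$, independent of $\kappa$, $y$, $\theta_0$ and $\zeta$, such that $1-\alpha\kappa+M\kappa^2<1$ for all $\kappa\in(0,\kappa_0]$ and $$\|g(\zeta)\|_{\mathcal X}\le\big(1-\alpha\kappa+M\kappa^2\big)\|\zeta\|_{\mathcal X}\qquad\text{for all }\zeta\in\mathcal X,\ \kappa\in(0,\kappa_0].$$ Consequently, for $\kappa\in(0,\kappa_0]$ the minimizer is an attractive fixed point: for every sequence of estimates $(\zeta_j,\hat\theta_j)$ generated by the iteration from an arbitrary starting pair,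 $\zeta_j\to\zeta^o$ and $\hat\theta_j\to\theta^o$ in norm. -/

import Mathlib

open Set Filter Topology MeasureTheory
open scoped InnerProductSpace

namespace SourceEstimation

noncomputable section

/-- A strongly continuous one-parameter group of bounded operators on `X`. -/
structure C0Group (𝕜 X : Type*) [RCLike 𝕜] [NormedAddCommGroup X] [InnerProductSpace 𝕜 X] where
  /-- The operator at time `t`. -/
  op : ℝ → X →L[𝕜] X
  op_zero : op 0 = ContinuousLinearMap.id 𝕜 X
  op_add : ∀ s t : ℝ, op (s + t) = (op s).comp (op t)
  continuous_op : ∀ x : X, Continuous fun t : ℝ => op t x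

/-- The time-reversed group `t ↦ S (-t)`; if `S` is generated by `A`, this one is generated
by `-A`. -/
def C0Group.reverse {𝕜 X : Type*} [RCLike 𝕜] [NormedAddCommGroup X] [InnerProductSpace 𝕜 X]
    (S : C0Group 𝕜 X) : C0Group 𝕜 X where
  op := fun t => S.op (-t)
  op_zero := by rw [neg_zero]; exact S.op_zero
  op_add := fun s t => by rw [neg_add]; exact S.op_add _ _
  continuous_op := fun x => (S.continuous_op x).comp continuous_neg

/-- The (in general unbounded) operator `A` is the generator of the group `S`, that is,
`S t = e^{At}`: a point `x` is in the domain of `A` with `A x = w` if and only if `t ↦ S t x` is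
differentiable at `0` with derivative `w`. -/
def C0Group.IsGeneratedBy {𝕜 X : Type*} [RCLike 𝕜] [NormedAddCommGroup X]
    [InnerProductSpace 𝕜 X] [NormedSpace ℝ X] (S : C0Group 𝕜 X) (A : X →ₗ.[𝕜] X) : Prop :=
  ∀ x w : X, (x, w) ∈ A.graph ↔ HasDerivAt (fun t : ℝ => S.op t x) w 0

/-- A densely defined operator is skew-adjoint if `A* = -A`, including equality of domains. -/
def IsSkewAdjointOp {𝕜 X : Type*} [RCLike 𝕜] [NormedAddCommGroup X] [InnerProductSpace 𝕜 X]
    [CompleteSpace X] (A : X →ₗ.[𝕜] X) : Prop :=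
  Dense (A.domain : Set X) ∧ A.adjoint = -A

/-- `z` is the mild solution on `[0,T]` of `z' = A z + G(t, z)`, `z(0) = z₀`, where `A` is the
generator of `S` (variation of constants formula). -/
def IsMildSolution {𝕜 X : Type*} [RCLike 𝕜] [NormedAddCommGroup X] [InnerProductSpace 𝕜 X]
    [NormedSpace ℝ X] (S : C0Group 𝕜 X) (T : ℝ) (G : ℝ → X → X) (z₀ : X) (z : ℝ → X) : Prop :=
  ContinuousOn z (Icc 0 T) ∧
    ∀ t ∈ Icc (0 : ℝ) T, z t = S.op t z₀ + ∫ s in (0 : ℝ)..t, S.op (t - s) (G s (z s))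

/-- The data of the linear source estimation problem `z' = A z + B θ`, `y = C z` on `[0,T]`. -/
structure Problem (𝕜 X Y Θ : Type*) [RCLike 𝕜]
    [NormedAddCommGroup X] [InnerProductSpace 𝕜 X]
    [NormedAddCommGroup Y] [InnerProductSpace 𝕜 Y]
    [NormedAddCommGroup Θ] [InnerProductSpace 𝕜 Θ] where
  /-- The length of the time interval. -/
  T : ℝ
  /-- The group `t ↦ e^{At}`. -/
  S : C0Group 𝕜 X
  /-- The time-dependent input operator. -/
  B : ℝ → Θ →L[𝕜] X
  /-- The observation operator. -/
  C : X →L[𝕜] Y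
  /-- The weight of the regularization term. -/
  U₀ : Θ →L[𝕜] Θ

section Method

variable {𝕜 X Y Θ : Type*} [RCLike 𝕜]
  [NormedAddCommGroup X] [InnerProductSpace 𝕜 X]
  [NormedAddCommGroup Y] [InnerProductSpace 𝕜 Y]
  [NormedAddCommGroup Θ] [InnerProductSpace 𝕜 Θ]

/-- The regularized output error of the parameter `ξ` and the trajectory `z`,
`⟨ξ - θ₀, U₀ (ξ - θ₀)⟩ + ∫₀ᵀ ‖y - C z‖²`. -/
def outputError (P : Problem 𝕜 X Y Θ) (y : ℝ → Y) (θ₀ ξ : Θ) (z : ℝ → X) : ℝ :=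
  RCLike.re ⟪ξ - θ₀, P.U₀ (ξ - θ₀)⟫_𝕜 + ∫ t in (0 : ℝ)..P.T, ‖y t - P.C (z t)‖ ^ 2

variable [CompleteSpace X] [NormedSpace ℝ X] [CompleteSpace Y]

/-- `z` is the observer trajectory `ẑ[ζ, ξ]` with collocated feedback and gain `κ`:
`z' = A z + B ξ + κ C* (y - C z)`, `z(0) = ζ`. -/
def IsObserver (P : Problem 𝕜 X Y Θ) (κ : ℝ) (y : ℝ → Y) (ζ : X) (ξ : Θ) (z : ℝ → X) : Prop :=
  IsMildSolution P.S P.T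
    (fun t x => P.B t ξ + κ • ContinuousLinearMap.adjoint P.C (y t - P.C x)) ζ z

/-- `(ζo, θo)` minimizes `(ζ, ξ) ↦ outputError P y θ₀ ξ ẑ[ζ, ξ]` over `X × Θ`, where `ẑ[ζ, ξ]` is
the observer trajectory with gain `κ`. -/
def IsMinimizer (P : Problem 𝕜 X Y Θ) (κ : ℝ) (y : ℝ → Y) (θ₀ : Θ) (ζo : X) (θo : Θ) : Prop :=
  ∃ zo : ℝ → X, IsObserver P κ y ζo θo zo ∧
    ∀ (ζ : X) (ξ : Θ) (z : ℝ → X), IsObserver P κ y ζ ξ z →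
      outputError P y θ₀ θo zo ≤ outputError P y θ₀ ξ z

/-- One iteration of back and forth nudging with a Gauss-Newton step, with gain `κ`. It takes the
old estimates `ζ` (initial state) and `θ` (parameter) to the new estimates `ζ'` and `θ'`.
The auxiliary trajectories are the forward observer `zf`, the sensitivity operator `Sens`, the
information operator `U`, the weighted innovation `η` and the backward observer `zb`. Since
`t ↦ Sens t` is only strongly continuous in general, `Sens` solves its equation pointwise on `Θ`,
and the equations of `U` and `η` are tested against vectors of `Θ`. -/
structure IsIteration (P : Problem 𝕜 X Y Θ) (κ : ℝ) (y : ℝ → Y) (θ₀ : Θ)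
    (ζ : X) (θ : Θ) (ζ' : X) (θ' : Θ)
    (zf : ℝ → X) (Sens : ℝ → Θ →L[𝕜] X) (U : ℝ → Θ →L[𝕜] Θ) (η : ℝ → Θ) (zb : ℝ → X) :
    Prop where
  /-- `zf' = A zf + κ C* (y - C zf) + B θ`, `zf(0) = ζ`. -/
  forward : IsObserver P κ y ζ θ zf
  /-- `Sens' = (A - κ C* C) Sens + B`, `Sens(0) = 0`. -/
  sensitivity : ∀ φ : Θ, IsMildSolution P.S P.T
    (fun t x => P.B t φ - κ • ContinuousLinearMap.adjoint P.C (P.C x)) 0 (fun t => Sens t φ)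
  /-- `U' = Sens* C* C Sens`, `U(0) = U₀`. -/
  information : ∀ t ∈ Icc (0 : ℝ) P.T, ∀ φ ψ : Θ,
    ⟪φ, U t ψ⟫_𝕜 = ⟪φ, P.U₀ ψ⟫_𝕜 + ∫ s in (0 : ℝ)..t, ⟪P.C (Sens s φ), P.C (Sens s ψ)⟫_𝕜
  /-- `η' = Sens* C* (y - C zf)`, `η(0) = 0`. -/
  innovation : ∀ t ∈ Icc (0 : ℝ) P.T, ∀ φ : Θ,
    ⟪φ, η t⟫_𝕜 = ∫ s in (0 : ℝ)..t, ⟪P.C (Sens s φ), y s - P.C (zf s)⟫_𝕜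
  /-- The operator `U(T)` has a bounded inverse. -/
  invertible : (U P.T).IsInvertible
  /-- `θ' = θ - U(T)⁻¹ (U₀ (θ - θ₀) - η(T))`. -/
  parameter : θ' = θ - (U P.T).inverse (P.U₀ (θ - θ₀) - η P.T)
  /-- `zb'(t) = -A zb(t) + κ C* (y(T - t) - C zb(t)) - B(T - t) θ'`,
  `zb(0) = zf(T) + Sens(T) (θ' - θ)`. -/
  backward : IsMildSolution P.S.reverse P.T
    (fun t x => κ • ContinuousLinearMap.adjoint P.C (y (P.T - t) - P.C x) - P.B (P.T - t) θ')
    (zf P.T + Sens P.T (θ' - θ)) zb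
  /-- `ζ' = zb(T)`. -/
  terminal : ζ' = zb P.T

/-- One iteration takes the pair of estimates `(ζ, θ)` to `(ζ', θ')`. -/
def Iterates (P : Problem 𝕜 X Y Θ) (κ : ℝ) (y : ℝ → Y) (θ₀ : Θ)
    (ζ : X) (θ : Θ) (ζ' : X) (θ' : Θ) : Prop :=
  ∃ (zf : ℝ → X) (Sens : ℝ → Θ →L[𝕜] X) (U : ℝ → Θ →L[𝕜] Θ) (η : ℝ → Θ) (zb : ℝ → X),
    IsIteration P κ y θ₀ ζ θ ζ' θ' zf Sens U η zb

/-- `f` is the map of the initial state estimates defined by one iteration: for every old pair of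
estimates `(ζ, θ)` the iteration can be carried out, and the new initial state estimate is always
`f ζ`, whatever the old parameter estimate `θ`. -/
def IsIterationMap (P : Problem 𝕜 X Y Θ) (κ : ℝ) (y : ℝ → Y) (θ₀ : Θ) (f : X → X) : Prop :=
  ∀ (ζ : X) (θ : Θ) (ζ' : X), (∃ θ' : Θ, Iterates P κ y θ₀ ζ θ ζ' θ') ↔ ζ' = f ζ

end Method

/-- The map `f` shifted so that the point `p` is moved to the origin. -/
def shiftedMap {X : Type*} [AddCommGroup X] (f : X → X) (p : X) : X → X :=
  fun ζ => f (ζ + p) - p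

/-- The rate `min (δ γ² / (T² ‖C‖² ‖B‖²), γ²)`, where the quotient is `+∞` if its denominator
vanishes. Here `b` stands for `‖B‖` and `c` for `‖C‖`. -/
def rate (δ γ T c b : ℝ) : ℝ :=
  if T ^ 2 * c ^ 2 * b ^ 2 = 0 then γ ^ 2
  else min (δ * γ ^ 2 / (T ^ 2 * c ^ 2 * b ^ 2)) (γ ^ 2)

end

end SourceEstimation

/-! One iteration is exactly a gradient step of size `κ` for the cost reduced to the initial state,
`ζ ↦ min_ξ J(ξ, ζ)`; the contraction rate comes from the coercivity of its Hessian.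

Skew-adjointness makes the group isometric, so it can be factored out: `z t = S t (ζ + ∫₀ᵗ p)`, with
transported drift `p = S⁻¹(B ξ + κ C* ι)` and innovation `ι = y - C z`. On `L²(0,T)` let `V` be the
primitive, `W` the embedding of constants and `G p = C S p`. With `K = G V G*`, `R₀ = G W`, `Q₀ = G
V S⁻¹ B`, the observer equation becomes `(1 + κ K) ι = y - R₀ ζ - Q₀ ξ`. Integration by parts is the
identity `V + V* = W W*` (`primitiveOp_add_adjoint`), hence `K + K* = R₀ R₀* ≥ 0`. So `1 + κ K` is
invertible, with inverse of norm at most one, for every `κ ≥ 0`. The innovation is therefore affine,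
`ι = h - R ζ - Q ξ` with `R = (1 + κ K)⁻¹ R₀` and `Q = (1 + κ K)⁻¹ Q₀`, and `J` is a regularized
linear least squares cost.

The Gauss–Newton step minimizes this quadratic cost in `ξ` exactly, which removes the old parameter.
The backward innovation satisfies `(1 + κ K*) ιb = (1 - κ K*) ι`, so `ι + ιb = 2 (1 + κ K*)⁻¹ ι` and
`ζ' = ζ + κ R₀* (ι + ιb) = ζ + 2 κ R* ι` (`backward_terminal`, `iterates_iff`).

Thus `g = 1 - 2 κ Σ` with `Σ` the `reducedHessian`. Cauchy–Schwarz gives `‖R ζ‖² ≤ (1 + q²/δ) Re⟨ζ,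
Σ ζ⟩` for `q = T ‖C‖ ‖B‖`, observability bounds `‖R ζ‖` below by `γ ‖ζ‖ / (1 + κ T ‖C‖²)`, and `α (1
+ q²/δ) ≤ 2 γ²`. All corrections are of second order in `κ`. -/

namespace SourceEstimation

open ContinuousLinearMap (adjoint adjoint_inner_left adjoint_inner_right)

noncomputable section

set_option linter.unusedSectionVars false

/-! ### Abstract regularized least squares and its reduced gradient step -/

section LeastSquares

variable {𝕜 X H Θ : Type*} [RCLike 𝕜]
  [NormedAddCommGroup X] [InnerProductSpace 𝕜 X] [CompleteSpace X]
  [NormedAddCommGroup H] [InnerProductSpace 𝕜 H] [CompleteSpace H]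
  [NormedAddCommGroup Θ] [InnerProductSpace 𝕜 Θ] [CompleteSpace Θ]

/-- The Lax–Milgram lemma. -/
lemma isInvertible_of_coercive (f : X →L[𝕜] X) {c : ℝ} (hc : 0 < c)
    (h : ∀ x, c * ‖x‖ ^ 2 ≤ RCLike.re ⟪x, f x⟫_𝕜) : f.IsInvertible := by
  have hu : IsUnit f := by
    refine ContinuousLinearMap.isUnit_of_forall_le_norm_inner_map f (c := ⟨c, hc.le⟩) hc fun x => ?_
    rw [norm_inner_symm, mul_comm]
    exact (h x).trans (RCLike.re_le_norm _)
  obtain ⟨u, hu⟩ := hu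
  exact ⟨ContinuousLinearEquiv.unitsEquiv 𝕜 X u, by ext x; simp [← hu]⟩

lemma inverse_apply_self {f : X →L[𝕜] X} (hf : f.IsInvertible) (x : X) : f.inverse (f x) = x :=
  hf.inverse_apply_eq.2 rfl

lemma apply_inverse_self {f : X →L[𝕜] X} (hf : f.IsInvertible) (x : X) : f (f.inverse x) = x :=
  (hf.inverse_apply_eq.1 rfl).symm

/-- The information operator `U + Q* Q`. -/
def informationOp (Q : Θ →L[𝕜] H) (U : Θ →L[𝕜] Θ) : Θ →L[𝕜] Θ := U + adjoint Q ∘L Q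

/-- The minimizer of `ξ ↦ ⟨ξ - θ₀, U (ξ - θ₀)⟩ + ‖h - R ζ - Q ξ‖²`. -/
def optimalParam (R : X →L[𝕜] H) (Q : Θ →L[𝕜] H) (U : Θ →L[𝕜] Θ) (h : H) (θ₀ : Θ) (ζ : X) : Θ :=
  (informationOp Q U).inverse (U θ₀ + adjoint Q (h - R ζ))

/-- The residual `h - R ζ - Q ξ` at the optimal parameter `ξ`. -/
def optimalResidual (R : X →L[𝕜] H) (Q : Θ →L[𝕜] H) (U : Θ →L[𝕜] Θ) (h : H) (θ₀ : Θ) (ζ : X) : H :=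
  h - R ζ - Q (optimalParam R Q U h θ₀ ζ)

/-- The gradient step for the reduced least squares cost. -/
def gradStep (R : X →L[𝕜] H) (Q : Θ →L[𝕜] H) (U : Θ →L[𝕜] Θ) (h : H) (θ₀ : Θ) (κ : ℝ) (ζ : X) :
    X :=
  ζ + (2 * κ : 𝕜) • adjoint R (optimalResidual R Q U h θ₀ ζ)

/-- The Hessian of the reduced least squares cost, up to the factor `2`. -/
def reducedHessian (R : X →L[𝕜] H) (Q : Θ →L[𝕜] H) (U : Θ →L[𝕜] Θ) : X →L[𝕜] X :=
  adjoint R ∘L (R - Q ∘L (informationOp Q U).inverse ∘L adjoint Q ∘L R)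

/-- The regularized least squares cost. -/
def lsCost (R : X →L[𝕜] H) (Q : Θ →L[𝕜] H) (U : Θ →L[𝕜] Θ) (h : H) (θ₀ : Θ) (ζ : X) (ξ : Θ) : ℝ :=
  RCLike.re ⟪ξ - θ₀, U (ξ - θ₀)⟫_𝕜 + ‖h - R ζ - Q ξ‖ ^ 2

variable {R : X →L[𝕜] H} {Q : Θ →L[𝕜] H} {U : Θ →L[𝕜] Θ} {h : H} {θ₀ : Θ} {δ : ℝ}

lemma informationOp_isInvertible (hδ : 0 < δ)
    (hU : ∀ φ : Θ, δ * ‖φ‖ ^ 2 ≤ RCLike.re ⟪φ, U φ⟫_𝕜) : (informationOp Q U).IsInvertible := by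
  refine isInvertible_of_coercive _ hδ fun φ => ?_
  have : RCLike.re ⟪φ, informationOp Q U φ⟫_𝕜 = RCLike.re ⟪φ, U φ⟫_𝕜 + ‖Q φ‖ ^ 2 := by
    simp [informationOp, inner_add_right, adjoint_inner_right]
  rw [this]
  nlinarith [hU φ, sq_nonneg ‖Q φ‖]

/-- The normal equation in `ξ`; later arguments use it instead of the inverse of the information
operator. -/
lemma optimalParam_normal (hW : (informationOp Q U).IsInvertible) (ζ : X) :
    U (optimalParam R Q U h θ₀ ζ - θ₀) = adjoint Q (optimalResidual R Q U h θ₀ ζ) := by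
  have h1 : informationOp Q U (optimalParam R Q U h θ₀ ζ) = U θ₀ + adjoint Q (h - R ζ) :=
    apply_inverse_self hW _
  simp only [informationOp, add_apply, ContinuousLinearMap.comp_apply] at h1
  simp only [optimalResidual, map_sub] at h1 ⊢
  rw [sub_eq_sub_iff_add_eq_add, h1]
  abel

/-- The optimal parameter is affine in `ζ`, and setting `h = 0`, `θ₀ = 0` selects its linear part.
-/
lemma optimalParam_sub (ζ ζ' : X) :
    optimalParam R Q U h θ₀ ζ - optimalParam R Q U h θ₀ ζ' = optimalParam R Q U 0 0 (ζ - ζ') := by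
  simp only [optimalParam, ← map_sub]
  congr 1
  simp only [map_sub, map_zero]
  abel

lemma optimalResidual_sub (ζ ζ' : X) :
    optimalResidual R Q U h θ₀ ζ - optimalResidual R Q U h θ₀ ζ' =
      optimalResidual R Q U 0 0 (ζ - ζ') := by
  simp only [optimalResidual, ← optimalParam_sub (h := h) (θ₀ := θ₀) ζ ζ', map_sub]
  abel

lemma reducedHessian_apply (ζ : X) :
    reducedHessian R Q U ζ = - adjoint R (optimalResidual R Q U 0 0 ζ) := by
  simp [reducedHessian, optimalResidual, optimalParam]
  abel

/-- The reduced quadratic form is the homogeneous cost at its optimal parameter `ξ`: substitute `R ζ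
= -e - Q ξ` and replace `Q* e` by `U ξ`. -/
lemma re_inner_reducedHessian (hW : (informationOp Q U).IsInvertible) (ζ : X) :
    RCLike.re ⟪ζ, reducedHessian R Q U ζ⟫_𝕜 = ‖optimalResidual R Q U 0 0 ζ‖ ^ 2 +
      RCLike.re ⟪optimalParam R Q U 0 0 ζ, U (optimalParam R Q U 0 0 ζ)⟫_𝕜 := by
  have hn := optimalParam_normal (R := R) (h := 0) (θ₀ := 0) hW ζ
  rw [sub_zero] at hn
  have hR : R ζ = - optimalResidual R Q U 0 0 ζ - Q (optimalParam R Q U 0 0 ζ) := by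
    simp [optimalResidual]
  rw [reducedHessian_apply, inner_neg_right, adjoint_inner_right, hR, hn, adjoint_inner_right,
    inner_sub_left, inner_neg_left]
  simp [add_comm]

/-- Since `R ζ = -(e + Q ξ)`, this is weighted Cauchy–Schwarz applied to `‖e‖ + q ‖ξ‖`, with weights
`1` and `δ`. -/
lemma reducedHessian_coercive (hδ : 0 < δ) (hU : ∀ φ : Θ, δ * ‖φ‖ ^ 2 ≤ RCLike.re ⟪φ, U φ⟫_𝕜)
    {q : ℝ} (hQ : ‖Q‖ ≤ q) (ζ : X) :
    ‖R ζ‖ ^ 2 ≤ (1 + q ^ 2 / δ) * RCLike.re ⟪ζ, reducedHessian R Q U ζ⟫_𝕜 := by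
  rw [re_inner_reducedHessian (informationOp_isInvertible hδ hU)]
  set e := optimalResidual R Q U 0 0 ζ with he
  set ξ := optimalParam R Q U 0 0 ζ with hξ
  have hq : 0 ≤ q := (norm_nonneg _).trans hQ
  have hR : R ζ = - (e + Q ξ) := by
    simp [he, hξ, optimalResidual]
  have h1 : ‖R ζ‖ ≤ ‖e‖ + q * ‖ξ‖ := by
    rw [hR, norm_neg]
    exact (norm_add_le _ _).trans (by gcongr; exact Q.le_of_opNorm_le hQ ξ)
  have h2 := hU ξ
  calc ‖R ζ‖ ^ 2 ≤ (‖e‖ + q * ‖ξ‖) ^ 2 := by gcongr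
    _ ≤ (1 + q ^ 2 / δ) * (‖e‖ ^ 2 + δ * ‖ξ‖ ^ 2) := by
      have : (1 + q ^ 2 / δ) * (‖e‖ ^ 2 + δ * ‖ξ‖ ^ 2) - (‖e‖ + q * ‖ξ‖) ^ 2
          = (q * ‖e‖ - δ * ‖ξ‖) ^ 2 / δ := by field_simp; ring
      have : 0 ≤ (q * ‖e‖ - δ * ‖ξ‖) ^ 2 / δ := by positivity
      linarith
    _ ≤ _ := by gcongr

/-- The form dominates `‖e‖²` and equals `-Re⟨R ζ, e⟩`, whence `‖e‖ ≤ ‖R ζ‖`; eliminating the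
parameter does not enlarge the residual. -/
lemma norm_reducedHessian_le (hδ : 0 < δ) (hU : ∀ φ : Θ, δ * ‖φ‖ ^ 2 ≤ RCLike.re ⟪φ, U φ⟫_𝕜)
    (ζ : X) : ‖reducedHessian R Q U ζ‖ ≤ ‖R‖ ^ 2 * ‖ζ‖ := by
  have h0 := re_inner_reducedHessian (R := R) (informationOp_isInvertible (Q := Q) hδ hU) ζ
  have hU0 : 0 ≤ RCLike.re ⟪optimalParam R Q U 0 0 ζ, U (optimalParam R Q U 0 0 ζ)⟫_𝕜 :=
    le_trans (by positivity) (hU _)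
  rw [reducedHessian_apply] at h0 ⊢
  set e := optimalResidual R Q U 0 0 ζ
  rw [inner_neg_right, adjoint_inner_right] at h0
  have h1 : ‖e‖ ^ 2 ≤ ‖R ζ‖ * ‖e‖ := by
    calc ‖e‖ ^ 2 ≤ RCLike.re (-⟪R ζ, e⟫_𝕜) := by linarith
      _ ≤ ‖-⟪R ζ, e⟫_𝕜‖ := RCLike.re_le_norm _
      _ ≤ _ := by rw [norm_neg]; exact norm_inner_le_norm _ _
  have h2 : ‖e‖ ≤ ‖R‖ * ‖ζ‖ := by
    refine le_trans ?_ (R.le_opNorm ζ)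
    rcases (norm_nonneg e).eq_or_lt with h | h
    · rw [← h]; positivity
    · exact le_of_mul_le_mul_right (by nlinarith) h
  rw [norm_neg]
  calc ‖adjoint R e‖ ≤ ‖adjoint R‖ * ‖e‖ := ContinuousLinearMap.le_opNorm _ _
    _ ≤ ‖R‖ * (‖R‖ * ‖ζ‖) := by rw [LinearIsometryEquiv.norm_map]; gcongr
    _ = _ := by ring

lemma gradStep_sub (κ : ℝ) (ζ ζ' : X) :
    gradStep R Q U h θ₀ κ ζ - gradStep R Q U h θ₀ κ ζ' =
      (ζ - ζ') - (2 * κ : 𝕜) • reducedHessian R Q U (ζ - ζ') := by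
  rw [reducedHessian_apply, ← optimalResidual_sub (h := h) (θ₀ := θ₀)]
  simp only [gradStep, map_sub, smul_neg, smul_sub]
  abel

/-- A gradient step contracts if the step size is small. -/
lemma norm_sub_smul_reducedHessian_le (hδ : 0 < δ)
    (hU : ∀ φ : Θ, δ * ‖φ‖ ^ 2 ≤ RCLike.re ⟪φ, U φ⟫_𝕜) {κ m c : ℝ} (hκ : 0 < κ)
    (hR : ‖R‖ ^ 2 ≤ c) (ζ : X)
    (hm : m * ‖ζ‖ ^ 2 ≤ 2 * RCLike.re ⟪ζ, reducedHessian R Q U ζ⟫_𝕜) :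
    ‖ζ - (2 * κ : 𝕜) • reducedHessian R Q U ζ‖ ≤ (1 - κ * m + 2 * c ^ 2 * κ ^ 2) * ‖ζ‖ := by
  have hS : ‖reducedHessian R Q U ζ‖ ≤ c * ‖ζ‖ :=
    (norm_reducedHessian_le hδ hU ζ).trans (by gcongr)
  set s := reducedHessian R Q U ζ
  rcases (norm_nonneg ζ).eq_or_lt with h0 | h0
  · have : ζ = 0 := norm_eq_zero.1 h0.symm
    simp [s, this]
  have hsq : ‖ζ - (2 * κ : 𝕜) • s‖ ^ 2
      = ‖ζ‖ ^ 2 - 4 * κ * RCLike.re ⟪ζ, s⟫_𝕜 + 4 * κ ^ 2 * ‖s‖ ^ 2 := by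
    have hn : ‖(2 * κ : 𝕜)‖ = 2 * κ := by
      rw [norm_mul, RCLike.norm_ofReal, abs_of_pos hκ]; simp
    have hi : RCLike.re ⟪ζ, (2 * κ : 𝕜) • s⟫_𝕜 = 2 * κ * RCLike.re ⟪ζ, s⟫_𝕜 := by
      rw [inner_smul_right, show (2 * κ : 𝕜) = ((2 * κ : ℝ) : 𝕜) by push_cast; rfl,
        RCLike.re_ofReal_mul]
    rw [norm_sub_sq (𝕜 := 𝕜), norm_smul, hn, hi]
    ring
  have hle : ‖ζ - (2 * κ : 𝕜) • s‖ ^ 2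
      ≤ (1 - 2 * κ * m + 4 * c ^ 2 * κ ^ 2) * ‖ζ‖ ^ 2 := by
    have hs2 : ‖s‖ ^ 2 ≤ c ^ 2 * ‖ζ‖ ^ 2 := by
      rw [← mul_pow]; gcongr
    rw [hsq]
    nlinarith [mul_le_mul_of_nonneg_left hm (by positivity : 0 ≤ 2 * κ),
      mul_le_mul_of_nonneg_left hs2 (by positivity : 0 ≤ 4 * κ ^ 2)]
  -- With `u = -κ m + 2 c² κ²` the squared factor is `1 + 2u ≤ (1 + u)²`. It is nonnegative because
  -- it bounds a square, and this makes `1 + u` nonnegative as well.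
  have hpos : 0 ≤ 1 - 2 * κ * m + 4 * c ^ 2 * κ ^ 2 :=
    nonneg_of_mul_nonneg_left ((sq_nonneg _).trans hle) (by positivity)
  refine abs_le_of_sq_le_sq' (?_ : _ ≤ ((1 - κ * m + 2 * c ^ 2 * κ ^ 2) * ‖ζ‖) ^ 2) ?_ |>.2
  · refine hle.trans ?_
    rw [mul_pow]
    gcongr
    nlinarith [sq_nonneg (- κ * m + 2 * c ^ 2 * κ ^ 2)]
  · refine mul_nonneg ?_ h0.le
    linarith

/-- The least squares cost has exactly one critical point, which is a fixed point of the gradient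
step and the strict minimizer. -/
lemma exists_lsCost_minimizer (hδ : 0 < δ) (hUs : IsSelfAdjoint U)
    (hU : ∀ φ : Θ, δ * ‖φ‖ ^ 2 ≤ RCLike.re ⟪φ, U φ⟫_𝕜) {r : ℝ} (hr : 0 < r)
    (hR : ∀ ζ, r * ‖ζ‖ ≤ ‖R ζ‖) (h : H) (θ₀ : Θ) :
    ∃ ζo : X, (∀ κ : ℝ, gradStep R Q U h θ₀ κ ζo = ζo) ∧
      (∀ ζ ξ, lsCost R Q U h θ₀ ζo (optimalParam R Q U h θ₀ ζo) ≤ lsCost R Q U h θ₀ ζ ξ) ∧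
      ∀ ζ ξ, lsCost R Q U h θ₀ ζ ξ ≤ lsCost R Q U h θ₀ ζo (optimalParam R Q U h θ₀ ζo) →
        ζ = ζo ∧ ξ = optimalParam R Q U h θ₀ ζo := by
  have hW := informationOp_isInvertible (Q := Q) hδ hU
  have hp : 0 < 1 + ‖Q‖ ^ 2 / δ := by positivity
  have hS : (reducedHessian R Q U).IsInvertible := by
    refine isInvertible_of_coercive _ (c := r ^ 2 / (1 + ‖Q‖ ^ 2 / δ)) (by positivity) fun ζ => ?_
    have h1 := reducedHessian_coercive (R := R) hδ hU le_rfl (Q := Q) ζ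
    have h2 : (r * ‖ζ‖) ^ 2 ≤ ‖R ζ‖ ^ 2 := by gcongr; exact hR ζ
    rw [div_mul_eq_mul_div, div_le_iff₀ hp, ← mul_pow, mul_comm (RCLike.re _)]
    exact h2.trans h1
  -- The residual is affine in `ζ`, so the critical point equation `R* e(ζ) = 0` is the linear
  -- equation `Σ ζ = R* e(0)`.
  set ζo := (reducedHessian R Q U).inverse (adjoint R (optimalResidual R Q U h θ₀ 0)) with hζo
  have hcrit : adjoint R (optimalResidual R Q U h θ₀ ζo) = 0 := by
    have h1 : reducedHessian R Q U ζo = adjoint R (optimalResidual R Q U h θ₀ 0) :=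
      apply_inverse_self hS _
    have h2 := optimalResidual_sub (R := R) (Q := Q) (U := U) (h := h) (θ₀ := θ₀) ζo 0
    rw [sub_zero] at h2
    rw [reducedHessian_apply, ← h2] at h1
    simpa using h1
  have hnorm := optimalParam_normal (R := R) (h := h) (θ₀ := θ₀) hW ζo
  -- Exact second order expansion at the critical point: the first order terms cancel by `R* e = 0`
  -- and the normal equation.
  have key : ∀ ζ ξ, lsCost R Q U h θ₀ ζ ξ = lsCost R Q U h θ₀ ζo (optimalParam R Q U h θ₀ ζo)
      + RCLike.re ⟪ξ - optimalParam R Q U h θ₀ ζo, U (ξ - optimalParam R Q U h θ₀ ζo)⟫_𝕜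
      + ‖R (ζ - ζo) + Q (ξ - optimalParam R Q U h θ₀ ζo)‖ ^ 2 := by
    intro ζ ξ
    set θo := optimalParam R Q U h θ₀ ζo
    set e := optimalResidual R Q U h θ₀ ζo with he
    have hξ : ξ - θ₀ = (θo - θ₀) + (ξ - θo) := by abel
    have hres : h - R ζ - Q ξ = e - (R (ζ - ζo) + Q (ξ - θo)) := by
      rw [he, optimalResidual, map_sub, map_sub]; abel
    have hreso : h - R ζo - Q θo = e := rfl
    have hsymm : ⟪θo - θ₀, U (ξ - θo)⟫_𝕜 = ⟪U (θo - θ₀), ξ - θo⟫_𝕜 := by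
      conv_rhs => rw [← hUs.adjoint_eq, adjoint_inner_left]
    have hc1 : ⟪e, R (ζ - ζo)⟫_𝕜 = 0 := by rw [← adjoint_inner_left, hcrit, inner_zero_left]
    rw [lsCost, lsCost, hres, hreso, hξ, map_add, inner_add_left, inner_add_right, inner_add_right,
      hsymm, hnorm, norm_sub_sq (𝕜 := 𝕜), inner_add_right, hc1, adjoint_inner_left,
      adjoint_inner_right Q (ξ - θo) e, ← inner_conj_symm e (Q (ξ - θo))]
    simp only [map_add, map_zero, RCLike.conj_re]
    ring
  refine ⟨ζo, fun κ => by simp [gradStep, hcrit], fun ζ ξ => ?_, fun ζ ξ hle => ?_⟩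
  · rw [key ζ ξ]
    have := (by positivity : 0 ≤ δ * ‖ξ - optimalParam R Q U h θ₀ ζo‖ ^ 2).trans (hU _)
    nlinarith [sq_nonneg ‖R (ζ - ζo) + Q (ξ - optimalParam R Q U h θ₀ ζo)‖]
  · rw [key ζ ξ] at hle
    have h1 := hU (ξ - optimalParam R Q U h θ₀ ζo)
    have h2 := sq_nonneg ‖R (ζ - ζo) + Q (ξ - optimalParam R Q U h θ₀ ζo)‖
    have h3 := sq_nonneg ‖ξ - optimalParam R Q U h θ₀ ζo‖
    have h4 : ‖ξ - optimalParam R Q U h θ₀ ζo‖ ^ 2 = 0 :=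
      le_antisymm (nonpos_of_mul_nonpos_right (by linarith) hδ) h3
    have h5 : ξ - optimalParam R Q U h θ₀ ζo = 0 := by simpa using h4
    rw [h5] at hle
    have h6 : ‖R (ζ - ζo)‖ ^ 2 ≤ 0 := by simpa using hle
    have h7 : ‖R (ζ - ζo)‖ = 0 := by
      have := le_antisymm h6 (sq_nonneg _)
      simpa using this
    have h8 : ‖ζ - ζo‖ ≤ 0 := nonpos_of_mul_nonpos_right ((hR _).trans h7.le) hr
    exact ⟨sub_eq_zero.1 (norm_le_zero_iff.1 h8), sub_eq_zero.1 h5⟩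

end LeastSquares

/-! ### Primitives, constants and inputs as operators on `L²(0,T)` -/

section TimeSpaces

variable {𝕜 X Y Θ : Type*} [RCLike 𝕜]
  [NormedAddCommGroup X] [InnerProductSpace 𝕜 X] [CompleteSpace X]
  [NormedSpace ℝ X] [IsScalarTower ℝ 𝕜 X]
  [NormedAddCommGroup Y] [InnerProductSpace 𝕜 Y] [CompleteSpace Y]
  [NormedAddCommGroup Θ] [InnerProductSpace 𝕜 Θ] [CompleteSpace Θ]

/-- Integration by parts for primitives. -/
lemma integral_inner_setIntegral_Iic_add {μ : Measure ℝ} [IsFiniteMeasure μ] [NullSingletonClass μ]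
    {p q : ℝ → X} (hp : Integrable p μ) (hq : Integrable q μ) :
    ∫ t, ⟪q t, ∫ s in Iic t, p s ∂μ⟫_𝕜 ∂μ + ∫ t, ⟪∫ s in Iic t, q s ∂μ, p t⟫_𝕜 ∂μ
      = ⟪∫ t, q t ∂μ, ∫ t, p t ∂μ⟫_𝕜 := by
  set F : ℝ × ℝ → 𝕜 := fun z => ⟪q z.1, p z.2⟫_𝕜 with hF
  have hFi : Integrable F (μ.prod μ) :=
    hq.op_fst_snd (op := fun x y => ⟪x, y⟫_𝕜) (by fun_prop)
      ⟨1, fun x y => by simpa using norm_inner_le_norm x y⟩ hp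
  -- Fubini: the two integrals on the left cover a triangle and its complement in the square. The
  -- complement is strict, so `Iio` must be exchanged for `Iic`, which costs nothing without atoms.
  set a : Set (ℝ × ℝ) := {z | z.2 ≤ z.1} with ha
  have ham : MeasurableSet a := measurableSet_le measurable_snd measurable_fst
  have h1 : ∫ t, ⟪q t, ∫ s in Iic t, p s ∂μ⟫_𝕜 ∂μ = ∫ z in a, F z ∂(μ.prod μ) := by
    rw [← integral_indicator ham, integral_prod _ (hFi.indicator ham)]
    congr 1 with t
    rw [← integral_inner hp.integrableOn, ← integral_indicator measurableSet_Iic]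
    rfl
  have h2 : ∫ t, ⟪∫ s in Iic t, q s ∂μ, p t⟫_𝕜 ∂μ = ∫ z in aᶜ, F z ∂(μ.prod μ) := by
    rw [← integral_indicator ham.compl, integral_prod_symm _ (hFi.indicator ham.compl)]
    congr 1 with s
    rw [← setIntegral_congr_set Iio_ae_eq_Iic, ← inner_conj_symm, ← integral_inner hq.integrableOn,
      ← integral_conj, ← integral_indicator measurableSet_Iio]
    congr 1 with t
    simp only [indicator, mem_Iio, ha, mem_compl_iff, mem_ofPred_eq, not_le, hF, inner_conj_symm]
  rw [h1, h2, integral_add_compl ham hFi, integral_prod _ hFi]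
  simp only [hF]
  simp_rw [integral_inner hp]
  simp_rw [← inner_conj_symm (q _)]
  rw [integral_conj, integral_inner hq, inner_conj_symm]

variable (T : ℝ)

/-- Lebesgue measure on the time interval `(0, T]`. -/
abbrev timeMeasure : Measure ℝ := volume.restrict (Ioc 0 T)

lemma timeMeasure_real_univ_rpow : (timeMeasure T).real univ ^ (1 / (2 : ENNReal).toReal) = √T := by
  rw [measureReal_restrict_apply_univ, Real.volume_real_Ioc, ENNReal.toReal_ofNat,
    ← Real.sqrt_eq_rpow, sub_zero]
  rcases le_total T 0 with h | h
  · rw [max_eq_right h, Real.sqrt_zero, Real.sqrt_eq_zero_of_nonpos h]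
  · rw [max_eq_left h]

lemma norm_setIntegral_le (s : Set ℝ) (p : Lp X 2 (timeMeasure T)) :
    ‖∫ t in s, p t ∂(timeMeasure T)‖ ≤ √T * ‖p‖ := by
  have hi : Integrable p (timeMeasure T) := (Lp.memLp p).integrable (by norm_num)
  calc ‖∫ t in s, p t ∂(timeMeasure T)‖ ≤ ∫ t in s, ‖p t‖ ∂(timeMeasure T) :=
        norm_integral_le_integral_norm _
    _ ≤ ∫ t, ‖p t‖ ∂(timeMeasure T) :=
        setIntegral_le_integral hi.norm (Eventually.of_forall fun _ => norm_nonneg _)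
    _ = (eLpNorm p 1 (timeMeasure T)).toReal := by
        rw [eLpNorm_one_eq_lintegral_enorm, integral_norm_eq_lintegral_enorm hi.1]
    _ ≤ (eLpNorm p 2 (timeMeasure T) *
          timeMeasure T univ ^ (1 / (1 : ENNReal).toReal - 1 / (2 : ENNReal).toReal)).toReal := by
        refine ENNReal.toReal_mono ?_ (eLpNorm_le_eLpNorm_mul_rpow_measure_univ (by norm_num) hi.1)
        exact ENNReal.mul_ne_top (Lp.eLpNorm_ne_top p)
          (ENNReal.rpow_ne_top_of_nonneg (by norm_num) (measure_ne_top _ _))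
    _ = √T * ‖p‖ := by
        rw [ENNReal.toReal_mul, ← Lp.norm_def, ← ENNReal.toReal_rpow, mul_comm,
          ← timeMeasure_real_univ_rpow]
        norm_num [measureReal_def]

variable (𝕜 X) in
/-- The integral over `(0, t]`, as a function of the integrand. -/
def partialIntegral (t : ℝ) : Lp X 2 (timeMeasure T) →L[𝕜] X :=
  LinearMap.mkContinuous
    { toFun := fun p => ∫ s in Iic t, p s ∂(timeMeasure T)
      map_add' := fun p q => by
        rw [← integral_add ((Lp.memLp p).integrable (by norm_num)).integrableOn
          ((Lp.memLp q).integrable (by norm_num)).integrableOn]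
        exact integral_congr_ae (ae_restrict_of_ae (Lp.coeFn_add p q))
      map_smul' := fun c p => by
        rw [RingHom.id_apply, ← integral_smul]
        exact integral_congr_ae (ae_restrict_of_ae (Lp.coeFn_smul c p)) }
    (√T) (norm_setIntegral_le T _)

variable {T}

lemma partialIntegral_apply (t : ℝ) (p : Lp X 2 (timeMeasure T)) :
    partialIntegral 𝕜 X T t p = ∫ s in Iic t, p s ∂(timeMeasure T) := rfl

lemma partialIntegral_eq {t : ℝ} (ht : t ∈ Icc 0 T) {g : ℝ → X} {p : Lp X 2 (timeMeasure T)}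
    (hg : p =ᵐ[timeMeasure T] g) : partialIntegral 𝕜 X T t p = ∫ s in (0 : ℝ)..t, g s := by
  have h : Iic t ∩ Ioc 0 T = Ioc 0 t := by
    ext s; simp only [mem_inter_iff, mem_Iic, mem_Ioc]
    exact ⟨fun h => ⟨h.2.1, h.1⟩, fun h => ⟨h.2, h.1, h.2.trans ht.2⟩⟩
  rw [partialIntegral_apply, integral_congr_ae (ae_restrict_of_ae hg),
    Measure.restrict_restrict measurableSet_Iic, h, intervalIntegral.integral_of_le ht.1]

lemma norm_partialIntegral_apply_le (t : ℝ) (p : Lp X 2 (timeMeasure T)) :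
    ‖partialIntegral 𝕜 X T t p‖ ≤ √T * ‖p‖ := norm_setIntegral_le T _ p

lemma continuous_partialIntegral (p : Lp X 2 (timeMeasure T)) :
    Continuous fun t => partialIntegral 𝕜 X T t p := by
  have hi : Integrable p (timeMeasure T) := (Lp.memLp p).integrable (by norm_num)
  have h : ∀ t, partialIntegral 𝕜 X T t p = (∫ s in Iic 0, p s ∂(timeMeasure T)) +
      ∫ s in (0 : ℝ)..t, p s ∂(timeMeasure T) := fun t => by
    rw [← intervalIntegral.integral_Iic_sub_Iic hi.integrableOn hi.integrableOn,
      partialIntegral_apply]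
    abel
  simp_rw [h]
  exact continuous_const.add
    (intervalIntegral.continuous_primitive (fun a b => hi.intervalIntegrable) 0)

lemma memLp_partialIntegral (p : Lp X 2 (timeMeasure T)) :
    MemLp (fun t => partialIntegral 𝕜 X T t p) 2 (timeMeasure T) :=
  MemLp.of_bound (continuous_partialIntegral p).aestronglyMeasurable _
    (Eventually.of_forall fun t => norm_partialIntegral_apply_le t p)

variable (𝕜 X T) in
/-- The Volterra operator `p ↦ ∫₀ᵗ p`. -/
def primitiveOp : Lp X 2 (timeMeasure T) →L[𝕜] Lp X 2 (timeMeasure T) :=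
  LinearMap.mkContinuous
    { toFun := fun p => (memLp_partialIntegral (𝕜 := 𝕜) p).toLp
      map_add' := fun p q => by
        rw [← MemLp.toLp_add]
        congr 1
        ext t
        exact map_add _ _ _
      map_smul' := fun c p => by
        rw [RingHom.id_apply, ← MemLp.toLp_const_smul]
        congr 1
        ext t
        exact map_smul _ _ _ }
    -- One `√T` is the pointwise Cauchy–Schwarz bound, the other is the `L²` norm of the constant
    -- one.
    (√T * √T) fun p => by
      have h := Lp.norm_le_of_ae_bound (f := (memLp_partialIntegral (𝕜 := 𝕜) p).toLp)
        (C := √T * ‖p‖) (by positivity) (by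
          filter_upwards [(memLp_partialIntegral (𝕜 := 𝕜) p).coeFn_toLp] with t ht
          rw [ht]
          exact norm_partialIntegral_apply_le t p)
      have h2 := timeMeasure_real_univ_rpow T
      rw [one_div, measureReal_def, ← coe_measureUnivNNReal] at h2
      rw [mul_assoc]
      exact h.trans_eq (congrArg (· * (√T * ‖p‖)) h2)

lemma primitiveOp_coeFn (p : Lp X 2 (timeMeasure T)) :
    primitiveOp 𝕜 X T p =ᵐ[timeMeasure T] fun t => partialIntegral 𝕜 X T t p :=
  (memLp_partialIntegral (𝕜 := 𝕜) p).coeFn_toLp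

lemma norm_primitiveOp_le (hT : 0 ≤ T) : ‖primitiveOp 𝕜 X T‖ ≤ T :=
  (LinearMap.mkContinuous_norm_le _ (by positivity) _).trans (Real.mul_self_sqrt hT).le

variable (𝕜 X T) in
/-- Constant functions of time. -/
def constOp : X →L[𝕜] Lp X 2 (timeMeasure T) := Lp.constL 2 (timeMeasure T) 𝕜

lemma constOp_coeFn (x : X) : constOp 𝕜 X T x =ᵐ[timeMeasure T] fun _ => x :=
  Lp.coeFn_const 2 (timeMeasure T) x

lemma norm_constOp_le : ‖constOp 𝕜 X T‖ ≤ √T :=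
  (Lp.norm_constL_le 2 (timeMeasure T) 𝕜).trans (timeMeasure_real_univ_rpow T).le

lemma adjoint_constOp_apply (p : Lp X 2 (timeMeasure T)) :
    adjoint (constOp 𝕜 X T) p = partialIntegral 𝕜 X T T p := by
  refine ext_inner_left 𝕜 fun x => ?_
  rw [adjoint_inner_right, L2.inner_def, partialIntegral_apply,
    Measure.restrict_restrict measurableSet_Iic,
    inter_eq_self_of_subset_right (Ioc_subset_Iic_self : Ioc 0 T ⊆ Iic T),
    ← integral_inner ((Lp.memLp p).integrable (by norm_num))]
  refine integral_congr_ae ?_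
  filter_upwards [constOp_coeFn (𝕜 := 𝕜) (T := T) x] with t ht
  rw [ht]

/-- The adjoint of `∫₀ᵗ` is `∫ₜᵀ`, so the sum is the full integral viewed as a constant function.
This is the source of all positivity in the feedback loop. -/
lemma primitiveOp_add_adjoint :
    primitiveOp 𝕜 X T + adjoint (primitiveOp 𝕜 X T) = constOp 𝕜 X T ∘L adjoint (constOp 𝕜 X T) := by
  refine ContinuousLinearMap.ext fun p => ext_inner_left 𝕜 fun q => ?_
  have hp : Integrable p (timeMeasure T) := (Lp.memLp p).integrable (by norm_num)
  have hq : Integrable q (timeMeasure T) := (Lp.memLp q).integrable (by norm_num)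
  have hw : ∀ r : Lp X 2 (timeMeasure T),
      adjoint (constOp 𝕜 X T) r = ∫ t, r t ∂(timeMeasure T) := fun r => by
    rw [adjoint_constOp_apply, partialIntegral_apply, Measure.restrict_restrict measurableSet_Iic,
      inter_eq_self_of_subset_right (Ioc_subset_Iic_self : Ioc 0 T ⊆ Iic T)]
  rw [add_apply, inner_add_right, adjoint_inner_right _ q p, ContinuousLinearMap.comp_apply,
    ← adjoint_inner_left (constOp 𝕜 X T) _ q, hw, hw, ← integral_inner_setIntegral_Iic_add hp hq,
    L2.inner_def, L2.inner_def]
  congr 1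
  · refine integral_congr_ae ?_
    filter_upwards [primitiveOp_coeFn (𝕜 := 𝕜) p] with t ht
    rw [ht, partialIntegral_apply]
  · refine integral_congr_ae ?_
    filter_upwards [primitiveOp_coeFn (𝕜 := 𝕜) q] with t ht
    rw [ht, partialIntegral_apply]

lemma adjoint_compLpL (C : X →L[𝕜] Y) :
    adjoint (C.compLpL 2 (timeMeasure T)) = (adjoint C).compLpL 2 (timeMeasure T) := by
  refine ContinuousLinearMap.ext fun w => ext_inner_left 𝕜 fun p => ?_
  rw [adjoint_inner_right, L2.inner_def, L2.inner_def]
  refine integral_congr_ae ?_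
  filter_upwards [C.coeFn_compLpL p, (adjoint C).coeFn_compLpL w] with t h1 h2
  rw [h1, h2, adjoint_inner_right]

section Input

variable {B : ℝ → Θ →L[𝕜] X}

lemma memLp_input (hB : MemLp B 2 (timeMeasure T)) (ξ : Θ) :
    MemLp (fun t => B t ξ) 2 (timeMeasure T) :=
  (ContinuousLinearMap.apply 𝕜 X ξ).comp_memLp' hB

/-- The map `ξ ↦ B ξ` into the functions of time. -/
def inputOp (hB : MemLp B 2 (timeMeasure T)) : Θ →L[𝕜] Lp X 2 (timeMeasure T) :=
  LinearMap.mkContinuous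
    { toFun := fun ξ => (memLp_input hB ξ).toLp
      map_add' := fun ξ ξ' => by
        rw [← MemLp.toLp_add]
        congr 1
        ext t
        exact map_add _ _ _
      map_smul' := fun c ξ => by
        rw [RingHom.id_apply, ← MemLp.toLp_const_smul]
        congr 1
        ext t
        exact map_smul _ _ _ }
    (eLpNorm B 2 (timeMeasure T)).toReal fun ξ => by
      rw [← Lp.norm_toLp B hB, mul_comm]
      refine Lp.norm_le_mul_norm_of_ae_le_mul ?_
      filter_upwards [(memLp_input hB ξ).coeFn_toLp, hB.coeFn_toLp] with t h1 h2
      simp only [LinearMap.coe_mk, AddHom.coe_mk]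
      rw [h1, h2, mul_comm]
      exact (B t).le_opNorm ξ

lemma inputOp_coeFn (hB : MemLp B 2 (timeMeasure T)) (ξ : Θ) :
    inputOp hB ξ =ᵐ[timeMeasure T] fun t => B t ξ :=
  (memLp_input hB ξ).coeFn_toLp

lemma norm_inputOp_le (hB : MemLp B 2 (timeMeasure T)) :
    ‖inputOp hB‖ ≤ (eLpNorm B 2 (timeMeasure T)).toReal :=
  LinearMap.mkContinuous_norm_le _ ENNReal.toReal_nonneg _

end Input

end TimeSpaces

/-! ### Isometric groups and their action on functions of time -/

section Group

variable {𝕜 X : Type*} [RCLike 𝕜] [NormedAddCommGroup X] [InnerProductSpace 𝕜 X]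

/-- All operators of the group are isometries. -/
def C0Group.IsIsometric (S : C0Group 𝕜 X) : Prop := ∀ (t : ℝ) (x : X), ‖S.op t x‖ = ‖x‖

namespace C0Group

variable {S : C0Group 𝕜 X}

lemma op_op (S : C0Group 𝕜 X) (s t : ℝ) (x : X) : S.op s (S.op t x) = S.op (s + t) x := by
  rw [S.op_add]; rfl

lemma op_neg_op (S : C0Group 𝕜 X) (t : ℝ) (x : X) : S.op (-t) (S.op t x) = x := by
  rw [op_op, neg_add_cancel, S.op_zero]; rfl

lemma op_op_neg (S : C0Group 𝕜 X) (t : ℝ) (x : X) : S.op t (S.op (-t) x) = x := by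
  rw [op_op, add_neg_cancel, S.op_zero]; rfl

lemma IsIsometric.reverse (hS : S.IsIsometric) : S.reverse.IsIsometric := fun t => hS (-t)

lemma IsIsometric.inner_op (hS : S.IsIsometric) (t : ℝ) (x x' : X) :
    ⟪S.op t x, x'⟫_𝕜 = ⟪x, S.op (-t) x'⟫_𝕜 := by
  have h := LinearIsometry.inner_map_map
    (⟨(S.op t : X →ₗ[𝕜] X), hS t⟩ : X →ₗᵢ[𝕜] X) x (S.op (-t) x')
  rw [← h]
  exact congrArg _ (S.op_op_neg t x').symm

/-- Strong continuity becomes joint continuity because every `S t` is 1-Lipschitz; this gives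
measurability of `t ↦ S t (p t)`. -/
lemma IsIsometric.continuous_uncurry (hS : S.IsIsometric) :
    Continuous fun z : ℝ × X => S.op z.1 z.2 := by
  refine continuous_prod_of_continuous_lipschitzWith' _ 1 (fun t => ?_) S.continuous_op
  refine LipschitzWith.of_dist_le_mul fun x x' => ?_
  rw [dist_eq_norm, dist_eq_norm, ← map_sub, hS]
  simp

lemma IsIsometric.memLp_op (hS : S.IsIsometric) {μ : Measure ℝ} {p : ℝ → X} (hp : MemLp p 2 μ) :
    MemLp (fun t => S.op t (p t)) 2 μ :=
  hp.of_le (hS.continuous_uncurry.comp_aestronglyMeasurable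
      (aestronglyMeasurable_id.prodMk hp.aestronglyMeasurable))
    (Eventually.of_forall fun t => (hS t (p t)).le)

/-- The isometry `p ↦ (t ↦ S t (p t))`. -/
def IsIsometric.timeOp (hS : S.IsIsometric) (T : ℝ) :
    Lp X 2 (timeMeasure T) →L[𝕜] Lp X 2 (timeMeasure T) :=
  LinearMap.mkContinuous
    { toFun := fun p => (hS.memLp_op (Lp.memLp p)).toLp
      map_add' := fun p q => by
        rw [← MemLp.toLp_add]
        refine MemLp.toLp_congr _ _ ?_
        filter_upwards [Lp.coeFn_add p q] with t ht
        rw [ht]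
        exact map_add _ _ _
      map_smul' := fun c p => by
        rw [RingHom.id_apply, ← MemLp.toLp_const_smul]
        refine MemLp.toLp_congr _ _ ?_
        filter_upwards [Lp.coeFn_smul c p] with t ht
        rw [ht]
        exact map_smul _ _ _ }
    1 fun p => by
      refine Lp.norm_le_mul_norm_of_ae_le_mul ?_
      filter_upwards [(hS.memLp_op (Lp.memLp p)).coeFn_toLp] with t ht
      rw [one_mul, ← hS t (p t), ← ht]
      rfl

lemma IsIsometric.timeOp_coeFn (hS : S.IsIsometric) {T : ℝ} (p : Lp X 2 (timeMeasure T)) :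
    hS.timeOp T p =ᵐ[timeMeasure T] fun t => S.op t (p t) :=
  (hS.memLp_op (Lp.memLp p)).coeFn_toLp

lemma IsIsometric.norm_timeOp_le (hS : S.IsIsometric) (T : ℝ) : ‖hS.timeOp T‖ ≤ 1 :=
  LinearMap.mkContinuous_norm_le _ zero_le_one _

lemma IsIsometric.adjoint_timeOp [CompleteSpace X] (hS : S.IsIsometric) (T : ℝ) :
    adjoint (hS.timeOp T) = hS.reverse.timeOp T := by
  refine ContinuousLinearMap.ext fun q => ext_inner_left 𝕜 fun p => ?_
  rw [adjoint_inner_right, L2.inner_def, L2.inner_def]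
  refine integral_congr_ae ?_
  filter_upwards [hS.timeOp_coeFn p, hS.reverse.timeOp_coeFn q] with t h1 h2
  rw [h1, h2]
  exact hS.inner_op t _ _

variable [CompleteSpace X] [NormedSpace ℝ X] [IsScalarTower ℝ 𝕜 X]

/-- A group generated by a skew-adjoint operator consists of isometries. -/
lemma IsGeneratedBy.isIsometric {A : X →ₗ.[𝕜] X} (hS : S.IsGeneratedBy A)
    (hA : IsSkewAdjointOp A) : S.IsIsometric := by
  have hderiv : ∀ x w, (x, w) ∈ A.graph → ∀ t, HasDerivAt (fun s => S.op s x) (S.op t w) t := by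
    intro x w hxw t
    have h0 : HasDerivAt (fun s => S.op s x) w (t - t) := by
      rw [sub_self]; exact (hS x w).1 hxw
    have h1 := (((S.op t).restrictScalars ℝ).hasFDerivAt (x := S.op (t - t) x)).comp_hasDerivAt t
      (h0.comp_sub_const t t)
    refine h1.congr_of_eventuallyEq (Eventually.of_forall fun s => ?_)
    simp [op_op]
  -- The domain is invariant under the group and the generator commutes with it.
  have hgraph : ∀ x w, (x, w) ∈ A.graph → ∀ t, (S.op t x, S.op t w) ∈ A.graph := by
    intro x w hxw t
    refine (hS _ _).2 ?_
    have h0 : HasDerivAt (fun s => S.op s x) (S.op t w) (0 + t) := by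
      rw [zero_add]; exact hderiv x w hxw t
    refine (h0.comp_add_const 0 t).congr_of_eventuallyEq (Eventually.of_forall fun s => ?_)
    simp [op_op]
  -- This is the derivative of `‖S t x‖²` at a point of the domain, so norms are conserved there;
  -- density extends the result to all of `X`.
  have hskew : ∀ x w, (x, w) ∈ A.graph → ⟪x, w⟫_𝕜 + ⟪w, x⟫_𝕜 = 0 := by
    intro x w hxw
    obtain ⟨u, rfl, rfl⟩ := (LinearPMap.mem_graph_iff A).1 hxw
    have hF := LinearPMap.adjoint_isFormalAdjoint hA.1
    rw [hA.2] at hF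
    have := hF u u
    rw [LinearPMap.neg_apply, inner_neg_left] at this
    rw [← this]
    simp
  have hdom : ∀ t, ∀ x ∈ (A.domain : Set X), ‖S.op t x‖ = ‖x‖ := by
    intro t x hx
    have hxw : (x, A ⟨x, hx⟩) ∈ A.graph := LinearPMap.mem_graph A ⟨x, hx⟩
    have hd : ∀ s, HasDerivAt (fun s => ⟪S.op s x, S.op s x⟫_𝕜) 0 s := fun s => by
      have h := (hderiv _ _ hxw s).inner 𝕜 (hderiv _ _ hxw s)
      rwa [hskew _ _ (hgraph _ _ hxw s)] at h
    have hc := is_const_of_deriv_eq_zero (fun s => (hd s).differentiableAt) (fun s => (hd s).deriv)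
      t 0
    have h0 : S.op 0 x = x := by rw [S.op_zero]; rfl
    rw [h0, inner_self_eq_norm_sq_to_K, inner_self_eq_norm_sq_to_K] at hc
    have hc' : ‖S.op t x‖ ^ 2 = ‖x‖ ^ 2 := by exact_mod_cast hc
    exact (pow_left_inj₀ (norm_nonneg _) (norm_nonneg _) two_ne_zero).1 hc'
  intro t x
  exact congrFun (Continuous.ext_on hA.1 (S.op t).continuous.norm continuous_norm (hdom t)) x

end C0Group

end Group

/-! ### Feedback loops whose open loop operator has positive real part -/

section Feedback

variable {𝕜 X H : Type*} [RCLike 𝕜]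
  [NormedAddCommGroup X] [InnerProductSpace 𝕜 X] [CompleteSpace X]
  [NormedAddCommGroup H] [InnerProductSpace 𝕜 H] [CompleteSpace H]

/-- The return difference operator `1 + κ K` of a feedback loop with gain `κ`. -/
def returnDiff (K : H →L[𝕜] H) (κ : ℝ) : H →L[𝕜] H := ContinuousLinearMap.id 𝕜 H + (κ : 𝕜) • K

variable {K : H →L[𝕜] H} {R : X →L[𝕜] H} {κ : ℝ}

lemma returnDiff_apply (w : H) : returnDiff K κ w = w + (κ : 𝕜) • K w := rfl

lemma adjoint_returnDiff_apply (w : H) :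
    adjoint (returnDiff K κ) w = w + (κ : 𝕜) • adjoint K w := by
  refine ext_inner_left 𝕜 fun v => ?_
  rw [adjoint_inner_right, returnDiff_apply, inner_add_left, inner_add_right, inner_smul_left,
    inner_smul_right, adjoint_inner_right, RCLike.conj_ofReal]

/-- The hypothesis says `2 Re⟨w, K w⟩ = ‖R* w‖²`, so feedback with `κ ≥ 0` only adds to the
identity. The factor `1` is the coercivity constant in `isInvertible_of_coercive`. -/
lemma norm_sq_le_re_inner_returnDiff (hK : K + adjoint K = R ∘L adjoint R) (hκ : 0 ≤ κ) (w : H) :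
    1 * ‖w‖ ^ 2 ≤ RCLike.re ⟪w, returnDiff K κ w⟫_𝕜 := by
  have h1 : ⟪w, K w⟫_𝕜 + ⟪w, adjoint K w⟫_𝕜 = ⟪adjoint R w, adjoint R w⟫_𝕜 := by
    rw [← inner_add_right, ← add_apply, hK, ContinuousLinearMap.comp_apply, adjoint_inner_left]
  rw [adjoint_inner_right, ← inner_conj_symm (K w) w] at h1
  have h2 := congrArg RCLike.re h1
  rw [map_add, RCLike.conj_re, inner_self_eq_norm_sq] at h2
  have h3 : 0 ≤ RCLike.re ⟪w, K w⟫_𝕜 := by nlinarith [sq_nonneg ‖adjoint R w‖]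
  rw [returnDiff_apply, inner_add_right, map_add, inner_self_eq_norm_sq, inner_smul_right,
    RCLike.re_ofReal_mul, one_mul]
  nlinarith [mul_nonneg hκ h3]

lemma returnDiff_isInvertible (hK : K + adjoint K = R ∘L adjoint R) (hκ : 0 ≤ κ) :
    (returnDiff K κ).IsInvertible :=
  isInvertible_of_coercive _ one_pos (norm_sq_le_re_inner_returnDiff hK hκ)

lemma norm_inverse_returnDiff_le (hK : K + adjoint K = R ∘L adjoint R) (hκ : 0 ≤ κ) :
    ‖(returnDiff K κ).inverse‖ ≤ 1 := by
  refine ContinuousLinearMap.opNorm_le_bound _ zero_le_one fun v => ?_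
  set w := (returnDiff K κ).inverse v with hw
  have hv : returnDiff K κ w = v := apply_inverse_self (returnDiff_isInvertible hK hκ) v
  have h1 := norm_sq_le_re_inner_returnDiff hK hκ w
  rw [hv] at h1
  have h2 := h1.trans ((RCLike.re_le_norm _).trans (norm_inner_le_norm w v))
  rcases (norm_nonneg w).eq_or_lt with h | h
  · rw [← h]; positivity
  · rw [one_mul]
    exact le_of_mul_le_mul_left (by nlinarith) h

lemma norm_returnDiff_apply_le {c : ℝ} (hc : ‖K‖ ≤ c) (hκ : 0 ≤ κ) (w : H) :
    ‖returnDiff K κ w‖ ≤ (1 + κ * c) * ‖w‖ := by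
  rw [returnDiff_apply]
  refine (norm_add_le _ _).trans ?_
  rw [norm_smul, RCLike.norm_ofReal, abs_of_nonneg hκ, add_mul, one_mul, mul_assoc]
  gcongr
  exact K.le_of_opNorm_le hc w

/-- The sum of the innovations of a feedback loop and of its time reversal. -/
lemma innovation_add_backward (hK : K + adjoint K = R ∘L adjoint R) (hκ : 0 ≤ κ) {ι ιb : H}
    (h : ιb + (κ : 𝕜) • adjoint K ιb = ι - (κ : 𝕜) • adjoint K ι) :
    ι + ιb = (2 : 𝕜) • adjoint (returnDiff K κ).inverse ι := by
  have hG : adjoint (returnDiff K κ).inverse ∘L adjoint (returnDiff K κ)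
      = ContinuousLinearMap.id 𝕜 H := by
    rw [← ContinuousLinearMap.adjoint_comp, (returnDiff_isInvertible hK hκ).self_comp_inverse,
      ContinuousLinearMap.adjoint_id]
  -- The terms `κ K* ι` cancel in `(1 + κ K*)(ι + ιb)`.
  have h1 : adjoint (returnDiff K κ) (ι + ιb) = (2 : 𝕜) • ι := by
    rw [map_add, adjoint_returnDiff_apply, adjoint_returnDiff_apply, h, two_smul]
    abel
  rw [← map_smul, ← h1]
  exact (congrArg (fun L : H →L[𝕜] H => L (ι + ιb)) hG).symm

/-- The time reversal of a feedback loop with innovation `ι` has an innovation. -/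
lemma exists_backward_innovation (hK : K + adjoint K = R ∘L adjoint R) (hκ : 0 ≤ κ) (ι : H) :
    ∃ ιb : H, ιb + (κ : 𝕜) • adjoint K ιb = ι - (κ : 𝕜) • adjoint K ι := by
  have hG : adjoint (returnDiff K κ) ∘L adjoint (returnDiff K κ).inverse
      = ContinuousLinearMap.id 𝕜 H := by
    rw [← ContinuousLinearMap.adjoint_comp, (returnDiff_isInvertible hK hκ).inverse_comp_self,
      ContinuousLinearMap.adjoint_id]
  refine ⟨adjoint (returnDiff K κ).inverse (ι - (κ : 𝕜) • adjoint K ι), ?_⟩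
  rw [← adjoint_returnDiff_apply]
  exact congrArg (fun L : H →L[𝕜] H => L (ι - (κ : 𝕜) • adjoint K ι)) hG

end Feedback

/-! ### Forward and backward observers as equations for their innovations -/

section Trajectories

variable {𝕜 X Y Θ : Type*} [RCLike 𝕜]
  [NormedAddCommGroup X] [InnerProductSpace 𝕜 X] [CompleteSpace X]
  [NormedSpace ℝ X] [IsScalarTower ℝ 𝕜 X]
  [NormedAddCommGroup Y] [InnerProductSpace 𝕜 Y] [CompleteSpace Y]
  [NormedAddCommGroup Θ] [InnerProductSpace 𝕜 Θ] [CompleteSpace Θ]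

lemma intervalIntegrable_of_coeFn {T a b : ℝ} (ha : a ∈ Icc 0 T) (hb : b ∈ Icc 0 T) {g : ℝ → X}
    {p : Lp X 2 (timeMeasure T)} (hp : p =ᵐ[timeMeasure T] g) :
    IntervalIntegrable g volume a b := by
  have hi : IntegrableOn g (Ioc 0 T) :=
    ((Lp.memLp p).integrable (by norm_num)).congr hp
  rw [intervalIntegrable_iff]
  exact hi.mono_set fun s hs => ⟨(le_min ha.1 hb.1).trans_lt hs.1, hs.2.trans (max_le ha.2 hb.2)⟩

namespace C0Group.IsIsometric

variable {S : C0Group 𝕜 X}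

/-- The variation of constants formula with the group factored out. -/
lemma isMildSolution_iff (hS : S.IsIsometric) {T : ℝ} {G : ℝ → X → X} {z₀ : X} {z : ℝ → X}
    {p : Lp X 2 (timeMeasure T)} (hp : p =ᵐ[timeMeasure T] fun s => S.op (-s) (G s (z s))) :
    IsMildSolution S T G z₀ z ↔
      ∀ t ∈ Icc 0 T, z t = S.op t (z₀ + partialIntegral 𝕜 X T t p) := by
  have key : ∀ t ∈ Icc 0 T, S.op t (z₀ + partialIntegral 𝕜 X T t p) =
      S.op t z₀ + ∫ s in (0 : ℝ)..t, S.op (t - s) (G s (z s)) := by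
    intro t ht
    rw [map_add, partialIntegral_eq ht hp, ← ContinuousLinearMap.intervalIntegral_comp_comm _
      (intervalIntegrable_of_coeFn ⟨le_rfl, ht.1.trans ht.2⟩ ht hp)]
    simp_rw [S.op_op, ← sub_eq_add_neg]
  constructor
  · intro h t ht
    rw [key t ht]
    exact h.2 t ht
  · intro h
    refine ⟨ContinuousOn.congr (Continuous.continuousOn ?_) h, fun t ht => ?_⟩
    · exact hS.continuous_uncurry.comp
        (continuous_id.prodMk (continuous_const.add (continuous_partialIntegral p)))
    · rw [← key t ht]
      exact h t ht

/-- The variation of constants formula for the reversed group, in reversed time. -/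
lemma isMildSolution_reverse_iff (hS : S.IsIsometric) {T : ℝ} (hT : 0 ≤ T) {G : ℝ → X → X} {z₀ : X}
    {z : ℝ → X} {p : Lp X 2 (timeMeasure T)}
    (hp : p =ᵐ[timeMeasure T] fun s => S.op (-s) (G (T - s) (z (T - s)))) :
    IsMildSolution S.reverse T G z₀ z ↔
      ∀ t ∈ Icc 0 T, z (T - t) = S.op t (S.op (-T) z₀ +
        (partialIntegral 𝕜 X T T p - partialIntegral 𝕜 X T t p)) := by
  have hTT : T ∈ Icc 0 T := ⟨hT, le_rfl⟩
  have h0T : (0 : ℝ) ∈ Icc 0 T := ⟨le_rfl, hT⟩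
  have hsub : ∀ t ∈ Icc 0 T, T - t ∈ Icc 0 T := fun t ht =>
    ⟨sub_nonneg.2 ht.2, sub_le_self _ ht.1⟩
  have key : ∀ t ∈ Icc 0 T, S.op t (S.op (-T) z₀ +
        (partialIntegral 𝕜 X T T p - partialIntegral 𝕜 X T t p)) =
      S.reverse.op (T - t) z₀ + ∫ s in (0 : ℝ)..(T - t), S.reverse.op (T - t - s) (G s (z s)) := by
    intro t ht
    -- Substitution `s ↦ T - s`.
    have h1 : ∫ s in (0 : ℝ)..(T - t), S.reverse.op (T - t - s) (G s (z s))
        = ∫ s in t..T, S.op t (S.op (-s) (G (T - s) (z (T - s)))) := by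
      have h2 := intervalIntegral.integral_comp_sub_left (a := t) (b := T)
        (fun s => S.reverse.op (T - t - s) (G s (z s))) T
      rw [sub_self] at h2
      rw [← h2]
      refine intervalIntegral.integral_congr fun s _ => ?_
      simp only [S.op_op, C0Group.reverse]
      congr 2
      ring
    rw [h1, ContinuousLinearMap.intervalIntegral_comp_comm _ (intervalIntegrable_of_coeFn ht hTT hp),
      partialIntegral_eq hTT hp, partialIntegral_eq ht hp,
      intervalIntegral.integral_interval_sub_left (intervalIntegrable_of_coeFn h0T hTT hp)
        (intervalIntegrable_of_coeFn h0T ht hp), map_add, S.op_op]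
    simp only [C0Group.reverse]
    congr 3
    ring
  constructor
  · intro h t ht
    rw [key t ht]
    exact h.2 (T - t) (hsub t ht)
  · intro h
    have h' : ∀ t ∈ Icc 0 T, z t = S.op (T - t) (S.op (-T) z₀ +
        (partialIntegral 𝕜 X T T p - partialIntegral 𝕜 X T (T - t) p)) := fun t ht => by
      have := h (T - t) (hsub t ht)
      rwa [sub_sub_cancel] at this
    refine ⟨ContinuousOn.congr (Continuous.continuousOn ?_) h', fun t ht => ?_⟩
    · exact hS.continuous_uncurry.comp ((continuous_const.sub continuous_id).prodMk
        (continuous_const.add (continuous_const.sub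
          ((continuous_partialIntegral p).comp (continuous_const.sub continuous_id)))))
    · rw [h' t ht, key (T - t) (hsub t ht), sub_sub_cancel]

end C0Group.IsIsometric

namespace Problem

variable (P : Problem 𝕜 X Y Θ) (hS : P.S.IsIsometric) (hB : MemLp P.B 2 (timeMeasure P.T))

/-- The output operator `p ↦ C S p` on functions of time. -/
def obsOp : Lp X 2 (timeMeasure P.T) →L[𝕜] Lp Y 2 (timeMeasure P.T) :=
  P.C.compLpL 2 (timeMeasure P.T) ∘L hS.timeOp P.T

/-- The input `ξ ↦ S⁻¹ B ξ`. -/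
def driveOp : Θ →L[𝕜] Lp X 2 (timeMeasure P.T) := hS.reverse.timeOp P.T ∘L inputOp hB

/-- The open loop operator from innovations to outputs. -/
def loopOp : Lp Y 2 (timeMeasure P.T) →L[𝕜] Lp Y 2 (timeMeasure P.T) :=
  P.obsOp hS ∘L primitiveOp 𝕜 X P.T ∘L adjoint (P.obsOp hS)

/-- The open loop operator from initial states to outputs. -/
def stateOp : X →L[𝕜] Lp Y 2 (timeMeasure P.T) := P.obsOp hS ∘L constOp 𝕜 X P.T

/-- The open loop operator from parameters to outputs. -/
def paramOp : Θ →L[𝕜] Lp Y 2 (timeMeasure P.T) :=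
  P.obsOp hS ∘L primitiveOp 𝕜 X P.T ∘L P.driveOp hS hB

/-- The drift of the observer with innovation `ι`, transported by the group. -/
def drift (κ : ℝ) (ξ : Θ) (ι : Lp Y 2 (timeMeasure P.T)) : Lp X 2 (timeMeasure P.T) :=
  P.driveOp hS hB ξ + (κ : 𝕜) • adjoint (P.obsOp hS) ι

variable {P}

lemma obsOp_coeFn (p : Lp X 2 (timeMeasure P.T)) :
    P.obsOp hS p =ᵐ[timeMeasure P.T] fun t => P.C (P.S.op t (p t)) := by
  filter_upwards [P.C.coeFn_compLpL (hS.timeOp P.T p), hS.timeOp_coeFn p] with t h1 h2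
  rw [← h2, ← h1]
  rfl

lemma adjoint_obsOp_coeFn (w : Lp Y 2 (timeMeasure P.T)) :
    adjoint (P.obsOp hS) w =ᵐ[timeMeasure P.T] fun t => P.S.op (-t) (adjoint P.C (w t)) := by
  rw [obsOp, ContinuousLinearMap.adjoint_comp, hS.adjoint_timeOp, adjoint_compLpL]
  filter_upwards [(adjoint P.C).coeFn_compLpL w,
    hS.reverse.timeOp_coeFn ((adjoint P.C).compLpL 2 (timeMeasure P.T) w)] with t h1 h2
  rw [← h1]
  exact h2

lemma driveOp_coeFn (ξ : Θ) :
    P.driveOp hS hB ξ =ᵐ[timeMeasure P.T] fun t => P.S.op (-t) (P.B t ξ) := by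
  filter_upwards [inputOp_coeFn hB ξ, hS.reverse.timeOp_coeFn (inputOp hB ξ)] with t h1 h2
  rw [← h1]
  exact h2

lemma loopOp_add_adjoint :
    P.loopOp hS + adjoint (P.loopOp hS) = P.stateOp hS ∘L adjoint (P.stateOp hS) := by
  have h := congrArg (fun L => P.obsOp hS ∘L L ∘L adjoint (P.obsOp hS))
    (primitiveOp_add_adjoint (𝕜 := 𝕜) (X := X) (T := P.T))
  simp only [loopOp, stateOp, ContinuousLinearMap.adjoint_comp, ContinuousLinearMap.adjoint_adjoint,
    ContinuousLinearMap.comp_assoc, ContinuousLinearMap.comp_add, ContinuousLinearMap.add_comp]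
    at h ⊢
  exact h

lemma norm_obsOp_le : ‖P.obsOp hS‖ ≤ ‖P.C‖ := by
  refine (ContinuousLinearMap.opNorm_comp_le _ _).trans ?_
  calc _ ≤ ‖P.C‖ * 1 := mul_le_mul (ContinuousLinearMap.norm_compLpL_le _)
        (hS.norm_timeOp_le P.T) (norm_nonneg _) (norm_nonneg _)
    _ = _ := mul_one _

lemma norm_driveOp_le : ‖P.driveOp hS hB‖ ≤ (eLpNorm P.B 2 (timeMeasure P.T)).toReal := by
  refine (ContinuousLinearMap.opNorm_comp_le _ _).trans ?_
  calc _ ≤ 1 * (eLpNorm P.B 2 (timeMeasure P.T)).toReal :=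
        mul_le_mul (hS.reverse.norm_timeOp_le P.T) (norm_inputOp_le hB) (norm_nonneg _) zero_le_one
    _ = _ := one_mul _

lemma norm_stateOp_le : ‖P.stateOp hS‖ ≤ ‖P.C‖ * √P.T :=
  (ContinuousLinearMap.opNorm_comp_le _ _).trans
    (mul_le_mul (norm_obsOp_le hS) norm_constOp_le (norm_nonneg _) (norm_nonneg _))

lemma norm_loopOp_le (hT : 0 ≤ P.T) : ‖P.loopOp hS‖ ≤ P.T * ‖P.C‖ ^ 2 := by
  have h := norm_obsOp_le hS
  calc ‖P.loopOp hS‖ ≤ ‖P.obsOp hS‖ * (‖primitiveOp 𝕜 X P.T‖ * ‖adjoint (P.obsOp hS)‖) :=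
        (ContinuousLinearMap.opNorm_comp_le _ _).trans
          (by gcongr; exact ContinuousLinearMap.opNorm_comp_le _ _)
    _ ≤ ‖P.C‖ * (P.T * ‖P.C‖) := by
        rw [LinearIsometryEquiv.norm_map]
        gcongr
        exact norm_primitiveOp_le hT
    _ = _ := by ring

lemma norm_paramOp_le (hT : 0 ≤ P.T) :
    ‖P.paramOp hS hB‖ ≤ P.T * ‖P.C‖ * (eLpNorm P.B 2 (timeMeasure P.T)).toReal := by
  calc ‖P.paramOp hS hB‖ ≤ ‖P.obsOp hS‖ * (‖primitiveOp 𝕜 X P.T‖ * ‖P.driveOp hS hB‖) :=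
        (ContinuousLinearMap.opNorm_comp_le _ _).trans
          (by gcongr; exact ContinuousLinearMap.opNorm_comp_le _ _)
    _ ≤ ‖P.C‖ * (P.T * (eLpNorm P.B 2 (timeMeasure P.T)).toReal) := by
        gcongr
        · exact norm_obsOp_le hS
        · exact norm_primitiveOp_le hT
        · exact norm_driveOp_le hS hB
    _ = _ := by ring

lemma stateOp_coeFn (x : X) :
    P.stateOp hS x =ᵐ[timeMeasure P.T] fun t => P.C (P.S.op t x) := by
  filter_upwards [obsOp_coeFn hS (constOp 𝕜 X P.T x), constOp_coeFn (𝕜 := 𝕜) (T := P.T) x]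
    with t h1 h2
  rw [h2] at h1
  exact h1

/-- The output of a trajectory that is given by its initial state and its transported drift. -/
lemma output_coeFn {z : ℝ → X} {x : X} {p : Lp X 2 (timeMeasure P.T)}
    (hz : ∀ t ∈ Icc 0 P.T, z t = P.S.op t (x + partialIntegral 𝕜 X P.T t p)) :
    P.obsOp hS (constOp 𝕜 X P.T x + primitiveOp 𝕜 X P.T p)
      =ᵐ[timeMeasure P.T] fun t => P.C (z t) := by
  filter_upwards [obsOp_coeFn hS (constOp 𝕜 X P.T x + primitiveOp 𝕜 X P.T p),
    constOp_coeFn (𝕜 := 𝕜) (T := P.T) x, primitiveOp_coeFn (𝕜 := 𝕜) p,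
    Lp.coeFn_add (constOp 𝕜 X P.T x) (primitiveOp 𝕜 X P.T p),
    ae_restrict_mem measurableSet_Ioc] with t h1 h2 h3 h4 h5
  rw [h1, h4, Pi.add_apply, h2, h3, hz t ⟨h5.1.le, h5.2⟩]

lemma memLp_output {z : ℝ → X} (hz : ContinuousOn z (Icc 0 P.T)) :
    MemLp (fun t => P.C (z t)) 2 (timeMeasure P.T) := by
  have hc : ContinuousOn (fun t => P.C (z t)) (Icc 0 P.T) := P.C.continuous.comp_continuousOn hz
  obtain ⟨b, hb⟩ := isCompact_Icc.exists_bound_of_continuousOn hc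
  refine MemLp.of_bound ((hc.mono Ioc_subset_Icc_self).aestronglyMeasurable measurableSet_Ioc) b ?_
  filter_upwards [ae_restrict_mem measurableSet_Ioc] with t ht
  exact hb t ⟨ht.1.le, ht.2⟩

lemma coeFn_eq_sub_iff {y w : ℝ → Y} (hy : MemLp y 2 (timeMeasure P.T))
    {W ι : Lp Y 2 (timeMeasure P.T)} (hW : W =ᵐ[timeMeasure P.T] w) :
    (ι =ᵐ[timeMeasure P.T] fun t => y t - w t) ↔ ι = hy.toLp - W := by
  have h : (hy.toLp - W : Lp Y 2 (timeMeasure P.T)) =ᵐ[timeMeasure P.T] fun t => y t - w t := by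
    filter_upwards [Lp.coeFn_sub hy.toLp W, hy.coeFn_toLp, hW] with t h1 h2 h3
    rw [h1, Pi.sub_apply, h2, h3]
  exact ⟨fun h' => Lp.ext (h'.trans h.symm), fun h' => by rw [h']; exact h⟩

/-- The innovation of the observer. -/
def innov (κ : ℝ) {y : ℝ → Y} (hy : MemLp y 2 (timeMeasure P.T)) (ζ : X) (ξ : Θ) :
    Lp Y 2 (timeMeasure P.T) :=
  (returnDiff (P.loopOp hS) κ).inverse (hy.toLp - P.stateOp hS ζ - P.paramOp hS hB ξ)

variable {κ : ℝ} {y : ℝ → Y} (hy : MemLp y 2 (timeMeasure P.T))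

lemma drift_coeFn {ξ : Θ} {z : ℝ → X} {ι : Lp Y 2 (timeMeasure P.T)}
    (hι : ι =ᵐ[timeMeasure P.T] fun t => y t - P.C (z t)) :
    P.drift hS hB κ ξ ι =ᵐ[timeMeasure P.T] fun t =>
      P.S.op (-t) (P.B t ξ + κ • adjoint P.C (y t - P.C (z t))) := by
  filter_upwards [hι, driveOp_coeFn hS hB ξ, adjoint_obsOp_coeFn hS ι,
    Lp.coeFn_add (P.driveOp hS hB ξ) ((κ : 𝕜) • adjoint (P.obsOp hS) ι),
    Lp.coeFn_smul (κ : 𝕜) (adjoint (P.obsOp hS) ι)] with t h1 h2 h3 h4 h5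
  rw [drift, h4, Pi.add_apply, h2, h5, Pi.smul_apply, h3, h1, map_add,
    RCLike.real_smul_eq_coe_smul (K := 𝕜), map_smul]

/-- A trajectory driven by `ι` has output `R₀ ζ + Q₀ ξ + κ K ι`; that `ι` is its own innovation is
thus the equation `(1 + κ K) ι = y - R₀ ζ - Q₀ ξ`. -/
lemma innov_coeFn_iff (hκ : 0 ≤ κ) {ζ : X} {ξ : Θ} {z : ℝ → X} {ι : Lp Y 2 (timeMeasure P.T)}
    (hz : ∀ t ∈ Icc 0 P.T, z t =
      P.S.op t (ζ + partialIntegral 𝕜 X P.T t (P.drift hS hB κ ξ ι))) :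
    (ι =ᵐ[timeMeasure P.T] fun t => y t - P.C (z t)) ↔ ι = innov hS hB κ hy ζ ξ := by
  rw [coeFn_eq_sub_iff hy (output_coeFn hS hz), innov,
    eq_comm (a := ι) (b := (returnDiff _ _).inverse _),
    (returnDiff_isInvertible (loopOp_add_adjoint hS) hκ).inverse_apply_eq, returnDiff_apply]
  have h : P.obsOp hS (constOp 𝕜 X P.T ζ + primitiveOp 𝕜 X P.T (P.drift hS hB κ ξ ι)) =
      P.stateOp hS ζ + P.paramOp hS hB ξ + (κ : 𝕜) • P.loopOp hS ι := by
    simp only [drift, map_add, map_smul, stateOp, paramOp, loopOp, ContinuousLinearMap.comp_apply,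
      add_assoc]
  rw [h, ← sub_sub, ← sub_sub, eq_sub_iff_add_eq, eq_comm]

/-- Yields existence, uniqueness on `[0,T]` and a formula at once: the innovation of any solution
solves the invertible loop equation. -/
lemma isObserver_iff (hκ : 0 ≤ κ) {ζ : X} {ξ : Θ} {z : ℝ → X} :
    IsObserver P κ y ζ ξ z ↔ ∀ t ∈ Icc 0 P.T, z t =
      P.S.op t (ζ + partialIntegral 𝕜 X P.T t (P.drift hS hB κ ξ (innov hS hB κ hy ζ ξ))) := by
  constructor
  · intro h
    have hm := hy.sub (memLp_output h.1)
    have hι : hm.toLp =ᵐ[timeMeasure P.T] fun t => y t - P.C (z t) := hm.coeFn_toLp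
    have hz := (hS.isMildSolution_iff
      (G := fun t x => P.B t ξ + κ • adjoint P.C (y t - P.C x)) (drift_coeFn hS hB hι)).1 h
    rwa [(innov_coeFn_iff hS hB hy hκ hz).1 hι] at hz
  · intro hz
    exact (hS.isMildSolution_iff
      (G := fun t x => P.B t ξ + κ • adjoint P.C (y t - P.C x))
      (drift_coeFn hS hB ((innov_coeFn_iff hS hB hy hκ hz).2 rfl))).2 hz

lemma innov_coeFn (hκ : 0 ≤ κ) {ζ : X} {ξ : Θ} {z : ℝ → X} (h : IsObserver P κ y ζ ξ z) :
    innov hS hB κ hy ζ ξ =ᵐ[timeMeasure P.T] fun t => y t - P.C (z t) :=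
  (innov_coeFn_iff hS hB hy hκ ((isObserver_iff hS hB hy hκ).1 h)).2 rfl

lemma exists_isObserver (hS : P.S.IsIsometric) (hB : MemLp P.B 2 (timeMeasure P.T))
    (hy : MemLp y 2 (timeMeasure P.T)) (hκ : 0 ≤ κ) (ζ : X) (ξ : Θ) : ∃ z, IsObserver P κ y ζ ξ z :=
  ⟨_, (isObserver_iff hS hB hy hκ).2 fun _ _ => rfl⟩

lemma innov_eq (ζ : X) (ξ : Θ) : innov hS hB κ hy ζ ξ =
    (returnDiff (P.loopOp hS) κ).inverse hy.toLp -
      ((returnDiff (P.loopOp hS) κ).inverse ∘L P.stateOp hS) ζ -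
      ((returnDiff (P.loopOp hS) κ).inverse ∘L P.paramOp hS hB) ξ := by
  simp only [innov, map_sub, ContinuousLinearMap.comp_apply]

/-- The unsimplified `P.T - (P.T - t)` matches the drift expected by `isMildSolution_reverse_iff`.
-/
lemma backward_drift_coeFn {θ : Θ} {z : ℝ → X} {ι : Lp Y 2 (timeMeasure P.T)}
    (hι : ι =ᵐ[timeMeasure P.T] fun t => y t - P.C (z (P.T - t))) :
    ((κ : 𝕜) • adjoint (P.obsOp hS) ι - P.driveOp hS hB θ : Lp X 2 (timeMeasure P.T))
      =ᵐ[timeMeasure P.T] fun t => P.S.op (-t)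
        (κ • adjoint P.C (y (P.T - (P.T - t)) - P.C (z (P.T - t))) - P.B (P.T - (P.T - t)) θ) := by
  filter_upwards [hι, driveOp_coeFn hS hB θ, adjoint_obsOp_coeFn hS ι,
    Lp.coeFn_sub ((κ : 𝕜) • adjoint (P.obsOp hS) ι) (P.driveOp hS hB θ),
    Lp.coeFn_smul (κ : 𝕜) (adjoint (P.obsOp hS) ι)] with t h1 h2 h3 h4 h5
  rw [h4, Pi.sub_apply, h2, h5, Pi.smul_apply, h3, h1, sub_sub_cancel,
    map_sub (P.S.op (-t)), RCLike.real_smul_eq_coe_smul (K := 𝕜), map_smul]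

/-- In forward time the backward trajectory starts from `ζ + ∫ drift + ∫ p` and has drift `-p`.
Replacing `W W*` by `V + V*` cancels the `V*` part of the source and leaves the output `R₀ ζ + Q₀ θ
+ κ (K + K*) ι + κ K* ιb`; comparison with the forward loop equation gives the claim. -/
lemma backward_coeFn_iff (hκ : 0 ≤ κ) {ζ : X} {θ : Θ} {z : ℝ → X}
    {ιb : Lp Y 2 (timeMeasure P.T)} {p : Lp X 2 (timeMeasure P.T)}
    (hp : p = (κ : 𝕜) • adjoint (P.obsOp hS) ιb - P.driveOp hS hB θ)
    (hz : ∀ t ∈ Icc 0 P.T, z (P.T - t) = P.S.op t (ζ +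
      partialIntegral 𝕜 X P.T P.T (P.drift hS hB κ θ (innov hS hB κ hy ζ θ)) +
        (partialIntegral 𝕜 X P.T P.T p - partialIntegral 𝕜 X P.T t p))) :
    (ιb =ᵐ[timeMeasure P.T] fun t => y t - P.C (z (P.T - t))) ↔
      ιb + (κ : 𝕜) • adjoint (P.loopOp hS) ιb =
        innov hS hB κ hy ζ θ - (κ : 𝕜) • adjoint (P.loopOp hS) (innov hS hB κ hy ζ θ) := by
  set ι := innov hS hB κ hy ζ θ with hι
  have hι' : ι + (κ : 𝕜) • P.loopOp hS ι = hy.toLp - P.stateOp hS ζ - P.paramOp hS hB θ :=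
    apply_inverse_self (returnDiff_isInvertible (loopOp_add_adjoint hS) hκ) _
  have hz' : ∀ t ∈ Icc 0 P.T, z (P.T - t) = P.S.op t ((ζ +
      partialIntegral 𝕜 X P.T P.T (P.drift hS hB κ θ ι) + partialIntegral 𝕜 X P.T P.T p) +
        partialIntegral 𝕜 X P.T t (-p)) := fun t ht => by
    rw [hz t ht, map_neg]
    congr 1
    abel
  have hcp : ∀ q : Lp X 2 (timeMeasure P.T), constOp 𝕜 X P.T (partialIntegral 𝕜 X P.T P.T q) =
      primitiveOp 𝕜 X P.T q + adjoint (primitiveOp 𝕜 X P.T) q := fun q => by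
    rw [← adjoint_constOp_apply, ← ContinuousLinearMap.comp_apply, ← primitiveOp_add_adjoint]
    rfl
  have hK : ∀ w, adjoint (P.loopOp hS) w =
      P.obsOp hS (adjoint (primitiveOp 𝕜 X P.T) (adjoint (P.obsOp hS) w)) := fun w => by
    simp only [loopOp, ContinuousLinearMap.adjoint_comp, ContinuousLinearMap.adjoint_adjoint,
      ContinuousLinearMap.comp_apply]
  have hout : P.obsOp hS (constOp 𝕜 X P.T (ζ +
      partialIntegral 𝕜 X P.T P.T (P.drift hS hB κ θ ι) + partialIntegral 𝕜 X P.T P.T p) +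
        primitiveOp 𝕜 X P.T (-p)) = P.stateOp hS ζ + P.paramOp hS hB θ +
      (κ : 𝕜) • (P.loopOp hS ι + adjoint (P.loopOp hS) ι) +
      (κ : 𝕜) • adjoint (P.loopOp hS) ιb := by
    rw [hK, hK]
    simp only [map_add, map_neg, hcp, hp, drift, map_sub, map_smul, stateOp, paramOp, loopOp,
      ContinuousLinearMap.comp_apply, smul_add]
    abel
  rw [coeFn_eq_sub_iff hy (output_coeFn hS (z := fun t => z (P.T - t)) hz'), hout]
  have hY : hy.toLp = ι + (κ : 𝕜) • P.loopOp hS ι + P.stateOp hS ζ + P.paramOp hS hB θ := by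
    rw [hι']; abel
  rw [hY, ← sub_eq_zero, ← sub_eq_zero (b := ι - _), smul_add]
  constructor <;> intro h <;> rw [← h] <;> abel

/-- The backward observer ends at the gradient step. -/
lemma backward_terminal (hT : 0 ≤ P.T) (hκ : 0 ≤ κ) {ζ : X} {θ : Θ} {zf zb : ℝ → X}
    (hf : IsObserver P κ y ζ θ zf)
    (hb : IsMildSolution P.S.reverse P.T
      (fun t x => κ • adjoint P.C (y (P.T - t) - P.C x) - P.B (P.T - t) θ) (zf P.T) zb) :
    zb P.T = ζ + (2 * κ : 𝕜) •
      adjoint ((returnDiff (P.loopOp hS) κ).inverse ∘L P.stateOp hS) (innov hS hB κ hy ζ θ) := by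
  have hmaps : MapsTo (fun t => P.T - t) (Icc 0 P.T) (Icc 0 P.T) := fun t ht =>
    ⟨sub_nonneg.2 ht.2, sub_le_self _ ht.1⟩
  have hm := hy.sub (memLp_output (hb.1.comp (continuous_const.sub continuous_id).continuousOn hmaps))
  set ιb : Lp Y 2 (timeMeasure P.T) := hm.toLp
  have hιb : ιb =ᵐ[timeMeasure P.T] fun t => y t - P.C (zb (P.T - t)) := hm.coeFn_toLp
  have hz := (hS.isMildSolution_reverse_iff hT (backward_drift_coeFn hS hB hιb)).1 hb
  rw [(isObserver_iff hS hB hy hκ).1 hf P.T ⟨hT, le_rfl⟩, P.S.op_neg_op] at hz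
  have heq := (backward_coeFn_iff hS hB hy hκ rfl hz).1 hιb
  have hsum := innovation_add_backward (loopOp_add_adjoint hS) hκ heq
  -- Time `0` of the forward clock is the end of the backward run: there the two source integrals
  -- cancel and only `κ R₀* (ι + ιb)` is added to `ζ`.
  have h0 := hz 0 ⟨le_rfl, hT⟩
  set ι := innov hS hB κ hy ζ θ
  have hI0 : ∀ p : Lp X 2 (timeMeasure P.T), partialIntegral 𝕜 X P.T 0 p = 0 := fun p => by
    rw [partialIntegral_eq ⟨le_rfl, hT⟩ (EventuallyEq.refl _ _), intervalIntegral.integral_same]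
  have hR : adjoint ((returnDiff (P.loopOp hS) κ).inverse ∘L P.stateOp hS) ι =
      partialIntegral 𝕜 X P.T P.T
        (adjoint (P.obsOp hS) (adjoint (returnDiff (P.loopOp hS) κ).inverse ι)) := by
    rw [← adjoint_constOp_apply]
    simp only [stateOp, ContinuousLinearMap.adjoint_comp, ContinuousLinearMap.comp_apply]
  have hstep : (2 * κ : 𝕜) •
      adjoint ((returnDiff (P.loopOp hS) κ).inverse ∘L P.stateOp hS) ι =
      (κ : 𝕜) • partialIntegral 𝕜 X P.T P.T (adjoint (P.obsOp hS) (ι + ιb)) := by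
    rw [hsum, map_smul, map_smul, hR, smul_smul, mul_comm]
  rw [sub_zero, hI0, sub_zero, P.S.op_zero] at h0
  rw [h0, hstep, drift]
  simp only [map_add, map_sub, map_smul, smul_add, ContinuousLinearMap.id_apply]
  abel

lemma exists_backward (hS : P.S.IsIsometric) (hB : MemLp P.B 2 (timeMeasure P.T))
    (hy : MemLp y 2 (timeMeasure P.T)) (hT : 0 ≤ P.T) (hκ : 0 ≤ κ) {ζ : X} {θ : Θ} {zf : ℝ → X}
    (hf : IsObserver P κ y ζ θ zf) : ∃ zb, IsMildSolution P.S.reverse P.T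
      (fun t x => κ • adjoint P.C (y (P.T - t) - P.C x) - P.B (P.T - t) θ) (zf P.T) zb := by
  obtain ⟨ιb, hιb⟩ := exists_backward_innovation (loopOp_add_adjoint hS) hκ
    (innov hS hB κ hy ζ θ)
  set p := (κ : 𝕜) • adjoint (P.obsOp hS) ιb - P.driveOp hS hB θ with hp
  set zb : ℝ → X := fun t => P.S.op (P.T - t) (ζ +
      partialIntegral 𝕜 X P.T P.T (P.drift hS hB κ θ (innov hS hB κ hy ζ θ)) +
        (partialIntegral 𝕜 X P.T P.T p - partialIntegral 𝕜 X P.T (P.T - t) p)) with hzb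
  have hz : ∀ t ∈ Icc 0 P.T, zb (P.T - t) = P.S.op t (ζ +
      partialIntegral 𝕜 X P.T P.T (P.drift hS hB κ θ (innov hS hB κ hy ζ θ)) +
        (partialIntegral 𝕜 X P.T P.T p - partialIntegral 𝕜 X P.T t p)) := fun t _ => by
    simp only [hzb, sub_sub_cancel]
  refine ⟨zb, (hS.isMildSolution_reverse_iff hT
    (backward_drift_coeFn hS hB ((backward_coeFn_iff hS hB hy hκ hp hz).2 hιb))).2 ?_⟩
  rw [(isObserver_iff hS hB hy hκ).1 hf P.T ⟨hT, le_rfl⟩, P.S.op_neg_op]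
  exact hz

end Problem

end Trajectories

/-! ### One iteration as a gradient step -/

section Iteration

variable {𝕜 X Y Θ : Type*} [RCLike 𝕜]
  [NormedAddCommGroup X] [InnerProductSpace 𝕜 X] [CompleteSpace X]
  [NormedSpace ℝ X] [IsScalarTower ℝ 𝕜 X]
  [NormedAddCommGroup Y] [InnerProductSpace 𝕜 Y] [CompleteSpace Y]
  [NormedAddCommGroup Θ] [InnerProductSpace 𝕜 Θ] [CompleteSpace Θ]

lemma norm_sq_eq_integral (𝕜 : Type*) {Y : Type*} [RCLike 𝕜] [NormedAddCommGroup Y]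
    [InnerProductSpace 𝕜 Y] {T : ℝ} (hT : 0 ≤ T) {w : ℝ → Y} {f : Lp Y 2 (timeMeasure T)}
    (hf : f =ᵐ[timeMeasure T] w) : ‖f‖ ^ 2 = ∫ t in (0 : ℝ)..T, ‖w t‖ ^ 2 := by
  have h : ((‖f‖ ^ 2 : ℝ) : 𝕜) = ((∫ t in (0 : ℝ)..T, ‖w t‖ ^ 2 : ℝ) : 𝕜) := by
    rw [intervalIntegral.integral_of_le hT, ← integral_ofReal, RCLike.ofReal_pow,
      ← inner_self_eq_norm_sq_to_K (𝕜 := 𝕜), L2.inner_def]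
    refine integral_congr_ae ?_
    filter_upwards [hf] with t ht
    rw [ht, inner_self_eq_norm_sq_to_K, RCLike.ofReal_pow]
  exact RCLike.ofReal_injective h

/-- Restriction to `(0, t]` turns the weak equations for `U t` and `η t` into adjoint formulas; it
serves to construct these trajectories at intermediate times. -/
lemma inner_restrict_eq_integral {T t : ℝ} (ht : t ∈ Icc 0 T) {v w : ℝ → Y}
    {f g : Lp Y 2 (timeMeasure T)} (hf : f =ᵐ[timeMeasure T] v) (hg : g =ᵐ[timeMeasure T] w) :
    ⟪LpToLpRestrictCLM ℝ Y 𝕜 (timeMeasure T) 2 (Iic t) f,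
      LpToLpRestrictCLM ℝ Y 𝕜 (timeMeasure T) 2 (Iic t) g⟫_𝕜 =
      ∫ s in (0 : ℝ)..t, ⟪v s, w s⟫_𝕜 := by
  have h : Iic t ∩ Ioc 0 T = Ioc 0 t := by
    ext s; simp only [mem_inter_iff, mem_Iic, mem_Ioc]
    exact ⟨fun h => ⟨h.2.1, h.1⟩, fun h => ⟨h.2, h.1, h.2.trans ht.2⟩⟩
  have h1 : ⟪LpToLpRestrictCLM ℝ Y 𝕜 (timeMeasure T) 2 (Iic t) f,
      LpToLpRestrictCLM ℝ Y 𝕜 (timeMeasure T) 2 (Iic t) g⟫_𝕜 =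
      ∫ s in Iic t, ⟪v s, w s⟫_𝕜 ∂(timeMeasure T) := by
    rw [L2.inner_def]
    refine integral_congr_ae ?_
    filter_upwards [LpToLpRestrictCLM_coeFn 𝕜 (Iic t) f, LpToLpRestrictCLM_coeFn 𝕜 (Iic t) g,
      ae_restrict_of_ae hf, ae_restrict_of_ae hg] with s h1 h2 h3 h4
    rw [h1, h2, h3, h4]
  rw [h1, Measure.restrict_restrict measurableSet_Iic, h, intervalIntegral.integral_of_le ht.1]

lemma inner_eq_integral {T : ℝ} (hT : 0 ≤ T) {v w : ℝ → Y}
    {f g : Lp Y 2 (timeMeasure T)} (hf : f =ᵐ[timeMeasure T] v) (hg : g =ᵐ[timeMeasure T] w) :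
    ⟪f, g⟫_𝕜 = ∫ s in (0 : ℝ)..T, ⟪v s, w s⟫_𝕜 := by
  rw [L2.inner_def, intervalIntegral.integral_of_le hT]
  refine integral_congr_ae ?_
  filter_upwards [hf, hg] with s h1 h2
  rw [h1, h2]

namespace Problem

variable (P : Problem 𝕜 X Y Θ) (hS : P.S.IsIsometric) (hB : MemLp P.B 2 (timeMeasure P.T))
  (κ : ℝ)

/-- The closed loop operator from initial states to outputs. -/
def closedStateOp : X →L[𝕜] Lp Y 2 (timeMeasure P.T) :=
  (returnDiff (P.loopOp hS) κ).inverse ∘L P.stateOp hS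

/-- The closed loop operator from parameters to outputs. -/
def closedParamOp : Θ →L[𝕜] Lp Y 2 (timeMeasure P.T) :=
  (returnDiff (P.loopOp hS) κ).inverse ∘L P.paramOp hS hB

/-- The innovation of the observer with zero initial state and zero parameter. -/
def closedOutput {y : ℝ → Y} (hy : MemLp y 2 (timeMeasure P.T)) : Lp Y 2 (timeMeasure P.T) :=
  (returnDiff (P.loopOp hS) κ).inverse hy.toLp

/-- The sensitivity operator. -/
def sensOp (t : ℝ) : Θ →L[𝕜] X :=
  P.S.op t ∘L partialIntegral 𝕜 X P.T t ∘L
    (P.driveOp hS hB - (κ : 𝕜) • (adjoint (P.obsOp hS) ∘L P.closedParamOp hS hB κ))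

variable {P κ} {y : ℝ → Y} (hy : MemLp y 2 (timeMeasure P.T)) {θ₀ : Θ}

lemma norm_closedStateOp_le (hκ : 0 ≤ κ) : ‖P.closedStateOp hS κ‖ ≤ ‖P.C‖ * √P.T :=
  (ContinuousLinearMap.opNorm_comp_le _ _).trans <|
    (mul_le_mul (norm_inverse_returnDiff_le (loopOp_add_adjoint hS) hκ) (norm_stateOp_le hS)
      (norm_nonneg _) zero_le_one).trans_eq (one_mul _)

lemma norm_closedParamOp_le (hT : 0 ≤ P.T) (hκ : 0 ≤ κ) : ‖P.closedParamOp hS hB κ‖ ≤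
    P.T * ‖P.C‖ * (eLpNorm P.B 2 (timeMeasure P.T)).toReal :=
  (ContinuousLinearMap.opNorm_comp_le _ _).trans <|
    (mul_le_mul (norm_inverse_returnDiff_le (loopOp_add_adjoint hS) hκ) (norm_paramOp_le hS hB hT)
      (norm_nonneg _) zero_le_one).trans_eq (one_mul _)

/-- Observability is inherited by the closed loop. -/
lemma le_norm_closedStateOp (hT : 0 ≤ P.T) (hκ : 0 ≤ κ) {γ : ℝ} (hγ : 0 ≤ γ)
    (hobs : ∀ x : X, γ ^ 2 * ‖x‖ ^ 2 ≤ ∫ t in (0 : ℝ)..P.T, ‖P.C (P.S.op t x)‖ ^ 2) (x : X) :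
    γ * ‖x‖ ≤ (1 + κ * (P.T * ‖P.C‖ ^ 2)) * ‖P.closedStateOp hS κ x‖ := by
  have h1 : γ * ‖x‖ ≤ ‖P.stateOp hS x‖ := by
    have h := hobs x
    rw [← norm_sq_eq_integral 𝕜 hT (stateOp_coeFn hS x), ← mul_pow] at h
    exact (pow_le_pow_iff_left₀ (by positivity) (norm_nonneg _) two_ne_zero).1 h
  have h2 : returnDiff (P.loopOp hS) κ (P.closedStateOp hS κ x) = P.stateOp hS x :=
    apply_inverse_self (returnDiff_isInvertible (loopOp_add_adjoint hS) hκ) _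
  rw [← h2] at h1
  exact h1.trans (norm_returnDiff_apply_le (norm_loopOp_le hS hT) hκ _)

lemma outputError_eq (hT : 0 ≤ P.T) (hκ : 0 ≤ κ) {ζ : X} {ξ : Θ} {z : ℝ → X}
    (h : IsObserver P κ y ζ ξ z) : outputError P y θ₀ ξ z =
      lsCost (P.closedStateOp hS κ) (P.closedParamOp hS hB κ) P.U₀
        (P.closedOutput hS κ hy) θ₀ ζ ξ := by
  rw [outputError, lsCost, ← norm_sq_eq_integral 𝕜 hT (innov_coeFn hS hB hy hκ h), innov_eq]
  rfl

/-- Each column of the sensitivity is an observer trajectory for zero data and zero initial state,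
so the observer formulas apply to it. -/
lemma sensitivity_iff {Sens : ℝ → Θ →L[𝕜] X} {φ : Θ} :
    IsMildSolution P.S P.T (fun t x => P.B t φ - κ • adjoint P.C (P.C x)) 0 (fun t => Sens t φ) ↔
      IsObserver P κ 0 0 φ (fun t => Sens t φ) := by
  have : (fun t x => P.B t φ - κ • adjoint P.C (P.C x)) =
      fun t x => P.B t φ + κ • adjoint P.C ((0 : ℝ → Y) t - P.C x) := by
    funext t x
    rw [Pi.zero_apply, zero_sub, map_neg, smul_neg, sub_eq_add_neg]
  rw [IsObserver, this]

lemma innov_zero (φ : Θ) :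
    innov hS hB κ (MemLp.zero : MemLp (0 : ℝ → Y) 2 (timeMeasure P.T)) 0 φ =
      - P.closedParamOp hS hB κ φ := by
  rw [innov_eq, MemLp.toLp_zero, map_zero, map_zero, sub_zero, zero_sub]
  rfl

lemma closedParamOp_coeFn (hκ : 0 ≤ κ) {Sens : ℝ → Θ →L[𝕜] X} {φ : Θ}
    (h : IsMildSolution P.S P.T (fun t x => P.B t φ - κ • adjoint P.C (P.C x)) 0
      (fun t => Sens t φ)) :
    P.closedParamOp hS hB κ φ =ᵐ[timeMeasure P.T] fun t => P.C (Sens t φ) := by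
  have h1 := innov_coeFn hS hB MemLp.zero hκ (sensitivity_iff.1 h)
  rw [innov_zero] at h1
  filter_upwards [h1, Lp.coeFn_neg (P.closedParamOp hS hB κ φ)] with t h2 h3
  rw [h3] at h2
  simpa using h2

lemma sensOp_sensitivity (hκ : 0 ≤ κ) (φ : Θ) :
    IsMildSolution P.S P.T (fun t x => P.B t φ - κ • adjoint P.C (P.C x)) 0
      (fun t => P.sensOp hS hB κ t φ) := by
  rw [sensitivity_iff, isObserver_iff hS hB MemLp.zero hκ]
  intro t _
  rw [innov_zero, drift, zero_add, map_neg, smul_neg, ← sub_eq_add_neg]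
  rfl

/-- The increment of the trajectory caused by a change of the parameter. -/
lemma observer_add_sens (hS : P.S.IsIsometric) (hB : MemLp P.B 2 (timeMeasure P.T))
    (hy : MemLp y 2 (timeMeasure P.T)) (hκ : 0 ≤ κ) {ζ : X} {θ θ' : Θ} {zf zf' : ℝ → X}
    {Sens : ℝ → Θ →L[𝕜] X}
    (hs : ∀ φ : Θ, IsMildSolution P.S P.T
      (fun t x => P.B t φ - κ • adjoint P.C (P.C x)) 0 (fun t => Sens t φ))
    (hf : IsObserver P κ y ζ θ zf) (hf' : IsObserver P κ y ζ θ' zf') {t : ℝ} (ht : t ∈ Icc 0 P.T) :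
    zf t + Sens t (θ' - θ) = zf' t := by
  have h := (isObserver_iff hS hB MemLp.zero hκ).1 (sensitivity_iff.1 (hs (θ' - θ))) t ht
  rw [(isObserver_iff hS hB hy hκ).1 hf t ht, (isObserver_iff hS hB hy hκ).1 hf' t ht, h,
    ← map_add]
  congr 1
  rw [innov_zero, innov_eq, innov_eq]
  simp only [drift, closedParamOp, map_add, map_sub, map_neg, map_smul, smul_sub, smul_neg]
  abel

variable {ζ ζ' : X} {θ θ' : Θ} {zf : ℝ → X} {Sens : ℝ → Θ →L[𝕜] X} {U : ℝ → Θ →L[𝕜] Θ} {η : ℝ → Θ}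
  {zb : ℝ → X}

lemma information_terminal (hT : 0 ≤ P.T) (hκ : 0 ≤ κ)
    (hs : ∀ φ : Θ, IsMildSolution P.S P.T
      (fun t x => P.B t φ - κ • adjoint P.C (P.C x)) 0 (fun t => Sens t φ))
    (hU : ∀ φ ψ : Θ, ⟪φ, U P.T ψ⟫_𝕜 =
      ⟪φ, P.U₀ ψ⟫_𝕜 + ∫ s in (0 : ℝ)..P.T, ⟪P.C (Sens s φ), P.C (Sens s ψ)⟫_𝕜) :
    U P.T = informationOp (P.closedParamOp hS hB κ) P.U₀ := by
  refine ContinuousLinearMap.ext fun ψ => ext_inner_left 𝕜 fun φ => ?_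
  rw [hU, informationOp, add_apply, inner_add_right, ContinuousLinearMap.comp_apply,
    adjoint_inner_right, inner_eq_integral hT (closedParamOp_coeFn hS hB hκ (hs φ))
      (closedParamOp_coeFn hS hB hκ (hs ψ))]

lemma innovation_terminal (hT : 0 ≤ P.T) (hκ : 0 ≤ κ)
    (hs : ∀ φ : Θ, IsMildSolution P.S P.T
      (fun t x => P.B t φ - κ • adjoint P.C (P.C x)) 0 (fun t => Sens t φ))
    (hf : IsObserver P κ y ζ θ zf)
    (hη : ∀ φ : Θ, ⟪φ, η P.T⟫_𝕜 = ∫ s in (0 : ℝ)..P.T, ⟪P.C (Sens s φ), y s - P.C (zf s)⟫_𝕜) :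
    η P.T = adjoint (P.closedParamOp hS hB κ) (innov hS hB κ hy ζ θ) := by
  refine ext_inner_left 𝕜 fun φ => ?_
  rw [hη, adjoint_inner_right, inner_eq_integral hT (closedParamOp_coeFn hS hB hκ (hs φ))
      (innov_coeFn hS hB hy hκ hf)]

/-- The Gauss–Newton step leads to the optimal parameter. -/
lemma gaussNewton_eq (hW : (informationOp (P.closedParamOp hS hB κ) P.U₀).IsInvertible) :
    θ - (informationOp (P.closedParamOp hS hB κ) P.U₀).inverse
        (P.U₀ (θ - θ₀) - adjoint (P.closedParamOp hS hB κ) (innov hS hB κ hy ζ θ)) =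
      optimalParam (P.closedStateOp hS κ) (P.closedParamOp hS hB κ) P.U₀
        (P.closedOutput hS κ hy) θ₀ ζ := by
  -- Writing `θ` as the inverse information operator applied to its image brings everything under
  -- one inverse, where all terms in `θ` cancel.
  conv_lhs => enter [1]; rw [← inverse_apply_self hW θ]
  rw [optimalParam, ← map_sub, innov_eq]
  congr 1
  simp only [informationOp, add_apply, ContinuousLinearMap.comp_apply, map_sub, closedStateOp,
    closedParamOp, closedOutput]
  abel

/-- One iteration is a gradient step for the reduced least squares cost. -/
lemma iterates_iff (hT : 0 ≤ P.T) (hκ : 0 ≤ κ) {δ : ℝ} (hδ : 0 < δ)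
    (hUδ : ∀ φ : Θ, δ * ‖φ‖ ^ 2 ≤ RCLike.re ⟪φ, P.U₀ φ⟫_𝕜) :
    Iterates P κ y θ₀ ζ θ ζ' θ' ↔
      ζ' = gradStep (P.closedStateOp hS κ) (P.closedParamOp hS hB κ) P.U₀ (P.closedOutput hS κ hy)
        θ₀ κ ζ ∧
      θ' = optimalParam (P.closedStateOp hS κ) (P.closedParamOp hS hB κ) P.U₀ (P.closedOutput hS κ hy)
        θ₀ ζ := by
  have hTT : P.T ∈ Icc 0 P.T := ⟨hT, le_rfl⟩
  have hW := informationOp_isInvertible (Q := P.closedParamOp hS hB κ) hδ hUδ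
  have hres : ∀ {θ'}, θ' = optimalParam (P.closedStateOp hS κ) (P.closedParamOp hS hB κ) P.U₀
      (P.closedOutput hS κ hy) θ₀ ζ → optimalResidual (P.closedStateOp hS κ) (P.closedParamOp hS hB κ)
        P.U₀ (P.closedOutput hS κ hy) θ₀ ζ = innov hS hB κ hy ζ θ' := by
    rintro θ' rfl
    rw [innov_eq]
    rfl
  constructor
  · rintro ⟨zf, Sens, U, η, zb, h⟩
    have hθ' : θ' = optimalParam (P.closedStateOp hS κ) (P.closedParamOp hS hB κ) P.U₀
        (P.closedOutput hS κ hy) θ₀ ζ := by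
      rw [h.parameter, information_terminal hS hB hT hκ h.sensitivity (h.information _ hTT),
        innovation_terminal hS hB hy hT hκ h.sensitivity h.forward (h.innovation _ hTT),
        gaussNewton_eq hS hB hy hW]
    refine ⟨?_, hθ'⟩
    -- The corrected final state is that of the observer run with `θ'`, so the backward run can be
    -- compared with this observer.
    obtain ⟨zf', hf'⟩ := exists_isObserver hS hB hy hκ ζ θ'
    have hb := h.backward
    rw [observer_add_sens hS hB hy hκ h.sensitivity h.forward hf' hTT] at hb
    rw [h.terminal, backward_terminal hS hB hy hT hκ hf' hb, gradStep, hres hθ']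
    rfl
  · rintro ⟨hζ', hθ'⟩
    obtain ⟨zf, hf⟩ := exists_isObserver hS hB hy hκ ζ θ
    obtain ⟨zf', hf'⟩ := exists_isObserver hS hB hy hκ ζ θ'
    obtain ⟨zb, hb⟩ := exists_backward hS hB hy hT hκ hf'
    have hs := sensOp_sensitivity (P := P) hS hB hκ
    set r := fun t : ℝ => LpToLpRestrictCLM ℝ Y 𝕜 (timeMeasure P.T) 2 (Iic t) with hr
    set Q := P.closedParamOp hS hB κ with hQ
    set U : ℝ → Θ →L[𝕜] Θ := fun t => P.U₀ + adjoint (r t ∘L Q) ∘L (r t ∘L Q) with hUdef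
    set η : ℝ → Θ := fun t => adjoint (r t ∘L Q) (r t (innov hS hB κ hy ζ θ)) with hηdef
    have hU : ∀ t ∈ Icc (0 : ℝ) P.T, ∀ φ ψ : Θ, ⟪φ, U t ψ⟫_𝕜 = ⟪φ, P.U₀ ψ⟫_𝕜 +
        ∫ s in (0 : ℝ)..t, ⟪P.C (P.sensOp hS hB κ s φ), P.C (P.sensOp hS hB κ s ψ)⟫_𝕜 := by
      intro t ht φ ψ
      rw [← inner_restrict_eq_integral ht (closedParamOp_coeFn hS hB hκ (hs φ))
        (closedParamOp_coeFn hS hB hκ (hs ψ)), hUdef, add_apply, inner_add_right,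
        ContinuousLinearMap.comp_apply, adjoint_inner_right]
      rfl
    have hη : ∀ t ∈ Icc (0 : ℝ) P.T, ∀ φ : Θ, ⟪φ, η t⟫_𝕜 =
        ∫ s in (0 : ℝ)..t, ⟪P.C (P.sensOp hS hB κ s φ), y s - P.C (zf s)⟫_𝕜 := by
      intro t ht φ
      rw [← inner_restrict_eq_integral ht (closedParamOp_coeFn hS hB hκ (hs φ))
        (innov_coeFn hS hB hy hκ hf), hηdef, adjoint_inner_right]
      rfl
    have hUT := information_terminal hS hB hT hκ hs (hU _ hTT)
    refine ⟨zf, P.sensOp hS hB κ, U, η, zb, hf, hs, hU, hη, hUT ▸ hW, ?_, ?_, ?_⟩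
    · rw [hUT, innovation_terminal hS hB hy hT hκ hs hf (hη _ hTT), gaussNewton_eq hS hB hy hW, hθ']
    · rw [observer_add_sens hS hB hy hκ hs hf hf' hTT]
      exact hb
    · rw [hζ', backward_terminal hS hB hy hT hκ hf' hb, gradStep, hres hθ']
      rfl

end Problem

end Iteration

/-! ### The rate constant and geometric convergence -/

section Rate

lemma rate_pos {δ γ T c b : ℝ} (hδ : 0 < δ) (hγ : 0 < γ) : 0 < rate δ γ T c b := by
  unfold rate
  split_ifs with h
  · positivity
  · have : 0 < T ^ 2 * c ^ 2 * b ^ 2 := lt_of_le_of_ne (by positivity) (Ne.symm h)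
    exact lt_min (by positivity) (by positivity)

/-- Each entry of the minimum controls one summand: `γ²` the `1`, the quotient the term `(T c b)² /
δ`. The latter vanishes in the degenerate case. -/
lemma rate_mul_le {δ γ T c b : ℝ} (hδ : 0 < δ) :
    rate δ γ T c b * (1 + (T * c * b) ^ 2 / δ) ≤ 2 * γ ^ 2 := by
  unfold rate
  rw [mul_pow, mul_pow]
  split_ifs with h
  · rw [h]
    rw [zero_div]
    nlinarith [sq_nonneg γ]
  · have hq : 0 < T ^ 2 * c ^ 2 * b ^ 2 := lt_of_le_of_ne (by positivity) (Ne.symm h)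
    set q := T ^ 2 * c ^ 2 * b ^ 2
    have h1 : min (δ * γ ^ 2 / q) (γ ^ 2) * (q / δ) ≤ γ ^ 2 := by
      calc _ ≤ δ * γ ^ 2 / q * (q / δ) := by gcongr; exact min_le_left _ _
        _ = γ ^ 2 := by field_simp
    have h2 := min_le_right (δ * γ ^ 2 / q) (γ ^ 2)
    linarith

lemma tendsto_of_norm_sub_le {X : Type*} [NormedAddCommGroup X] {z : ℕ → X} {p : X} {ρ : ℝ}
    (hρ : ρ < 1) (h : ∀ j, ‖z (j + 1) - p‖ ≤ ρ * ‖z j - p‖) : Tendsto z atTop (𝓝 p) := by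
  -- The truncation at `0` is needed because `ρ` may be negative.
  have hb : ∀ j, ‖z j - p‖ ≤ max ρ 0 ^ j * ‖z 0 - p‖ := by
    intro j
    induction j with
    | zero => simp
    | succ j ih =>
      calc ‖z (j + 1) - p‖ ≤ max ρ 0 * ‖z j - p‖ :=
            (h j).trans (by gcongr; exact le_max_left _ _)
        _ ≤ max ρ 0 * (max ρ 0 ^ j * ‖z 0 - p‖) := by gcongr
        _ = _ := by ring
  refine tendsto_iff_norm_sub_tendsto_zero.2
    (squeeze_zero (fun _ => norm_nonneg _) hb ?_)
  simpa using (tendsto_pow_atTop_nhds_zero_of_lt_one (le_max_right ρ 0)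
    (max_lt hρ one_pos)).mul_const ‖z 0 - p‖

end Rate

end

end SourceEstimation

/-! ### The main theorem -/

open SourceEstimation in
theorem theorem3p2 {𝕜 X Y Θ : Type*} [RCLike 𝕜]
    [NormedAddCommGroup X] [InnerProductSpace 𝕜 X] [CompleteSpace X]
    [NormedSpace ℝ X] [IsScalarTower ℝ 𝕜 X]
    [NormedAddCommGroup Y] [InnerProductSpace 𝕜 Y] [CompleteSpace Y]
    [NormedAddCommGroup Θ] [InnerProductSpace 𝕜 Θ] [CompleteSpace Θ]
    (P : Problem 𝕜 X Y Θ) (hT : 0 < P.T)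
    -- `A` is skew-adjoint and `P.S t = e^{At}`
    (A : X →ₗ.[𝕜] X) (hA : IsSkewAdjointOp A) (hS : P.S.IsGeneratedBy A)
    -- `B ∈ L²(0, T; L(Θ, X))`
    (hB : MemLp P.B 2 (volume.restrict (Ioc 0 P.T)))
    -- exact observability with constant `γ`
    (γ : ℝ) (hγ : 0 < γ)
    (hobs : ∀ x : X, γ ^ 2 * ‖x‖ ^ 2 ≤ ∫ t in (0 : ℝ)..P.T, ‖P.C (P.S.op t x)‖ ^ 2)
    -- `U₀` is self-adjoint and `U₀ ≥ δ I`
    (hU : IsSelfAdjoint P.U₀) (δ : ℝ) (hδ : 0 < δ)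
    (hUδ : ∀ φ : Θ, δ * ‖φ‖ ^ 2 ≤ RCLike.re ⟪φ, P.U₀ φ⟫_𝕜)
    (α : ℝ)
    (hα : α = rate δ γ P.T ‖P.C‖ (eLpNorm P.B 2 (volume.restrict (Ioc 0 P.T))).toReal) :
    ∃ M κ₀ : ℝ, 0 < κ₀ ∧
      (∀ κ : ℝ, 0 < κ → κ ≤ κ₀ → 1 - α * κ + M * κ ^ 2 < 1) ∧
      ∀ κ : ℝ, 0 < κ →
      ∀ y : ℝ → Y, MemLp y 2 (volume.restrict (Ioc 0 P.T)) → ∀ θ₀ : Θ,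
        ∃ (f : X → X) (ζo : X) (θo : Θ),
          IsIterationMap P κ y θ₀ f ∧
          IsMinimizer P κ y θ₀ ζo θo ∧
          (∀ (ζ : X) (ξ : Θ), IsMinimizer P κ y θ₀ ζ ξ → ζ = ζo ∧ ξ = θo) ∧
          f ζo = ζo ∧
          (κ ≤ κ₀ →
            (∀ ζ : X, ‖shiftedMap f ζo ζ‖ ≤ (1 - α * κ + M * κ ^ 2) * ‖ζ‖) ∧
            ∀ (z : ℕ → X) (ϑ : ℕ → Θ),
              (∀ j : ℕ, Iterates P κ y θ₀ (z j) (ϑ j) (z (j + 1)) (ϑ (j + 1))) →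
              Tendsto z atTop (𝓝 ζo) ∧ Tendsto ϑ atTop (𝓝 θo)) := by
  have hiso := hS.isIsometric hA
  have hα0 : 0 < α := hα ▸ rate_pos hδ hγ
  set c : ℝ := P.T * ‖P.C‖ ^ 2 with hc
  have hc0 : 0 ≤ c := by positivity
  -- The term `2 c α` is the loss of observability in the closed loop, where `m = α (1 - 2 κ c)`;
  -- the term `2 c²` is the second order term of the gradient step.
  set M : ℝ := 2 * c * α + 2 * c ^ 2 with hM
  have hM0 : 0 ≤ M := by positivity
  -- From `κ (M + 1) ≤ α` follows `M κ² - α κ ≤ -κ² < 0`.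
  have hlt : ∀ κ : ℝ, 0 < κ → κ ≤ α / (M + 1) → 1 - α * κ + M * κ ^ 2 < 1 := by
    intro κ hκ hκ'
    rw [le_div_iff₀ (by positivity)] at hκ'
    nlinarith
  refine ⟨M, α / (M + 1), by positivity, hlt, fun κ hκ y hy θ₀ => ?_⟩
  set R := P.closedStateOp hiso κ with hR
  set Q := P.closedParamOp hiso hB κ with hQ
  set h := P.closedOutput hiso κ hy with hh
  have hiter : ∀ {ζ θ ζ' θ'}, Iterates P κ y θ₀ ζ θ ζ' θ' ↔
      ζ' = gradStep R Q P.U₀ h θ₀ κ ζ ∧ θ' = optimalParam R Q P.U₀ h θ₀ ζ :=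
    Problem.iterates_iff hiso hB hy hT.le hκ.le hδ hUδ
  have hobsR := Problem.le_norm_closedStateOp hiso hT.le hκ.le hγ.le hobs
  have hRlow : ∀ ζ, γ / (1 + κ * c) * ‖ζ‖ ≤ ‖R ζ‖ := fun ζ => by
    rw [div_mul_eq_mul_div, div_le_iff₀ (by positivity), mul_comm ‖R ζ‖]
    exact hobsR ζ
  obtain ⟨ζo, hfix, hmin, huniq⟩ := exists_lsCost_minimizer (Q := Q) hδ hU hUδ
    (by positivity : 0 < γ / (1 + κ * c)) hRlow h θ₀
  have hcost : ∀ {ζ ξ z}, IsObserver P κ y ζ ξ z →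
      outputError P y θ₀ ξ z = lsCost R Q P.U₀ h θ₀ ζ ξ :=
    fun hz => Problem.outputError_eq hiso hB hy hT.le hκ.le hz
  obtain ⟨zo, hzo⟩ := Problem.exists_isObserver hiso hB hy hκ.le ζo (optimalParam R Q P.U₀ h θ₀ ζo)
  refine ⟨gradStep R Q P.U₀ h θ₀ κ, ζo, optimalParam R Q P.U₀ h θ₀ ζo, ?_, ⟨zo, hzo, ?_⟩, ?_, hfix κ,
    fun hκ' => ?_⟩
  · intro ζ θ ζ'
    exact ⟨fun ⟨θ', h'⟩ => (hiter.1 h').1, fun h' => ⟨_, hiter.2 ⟨h', rfl⟩⟩⟩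
  · intro ζ ξ z hz
    rw [hcost hzo, hcost hz]
    exact hmin ζ ξ
  · rintro ζ ξ ⟨z, hz, hzmin⟩
    refine huniq ζ ξ ?_
    rw [← hcost hzo, ← hcost hz]
    exact hzmin _ _ _ hzo
  · have hrate : ∀ ζ : X, α * (1 - 2 * κ * c) * ‖ζ‖ ^ 2 ≤
        2 * RCLike.re ⟪ζ, reducedHessian R Q P.U₀ ζ⟫_𝕜 := by
      intro ζ
      have h1 := reducedHessian_coercive (R := R) hδ hUδ
        (Problem.norm_closedParamOp_le hiso hB hT.le hκ.le) ζ
      have h2 : γ ^ 2 * ‖ζ‖ ^ 2 ≤ (1 + κ * c) ^ 2 * ‖R ζ‖ ^ 2 := by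
        rw [← mul_pow, ← mul_pow]
        exact pow_le_pow_left₀ (by positivity) (hobsR ζ) 2
      have h3 := rate_mul_le (γ := γ) (T := P.T) (c := ‖P.C‖)
        (b := (eLpNorm P.B 2 (volume.restrict (Ioc 0 P.T))).toReal) hδ
      rw [← hα] at h3
      set p := 1 + (P.T * ‖P.C‖ * (eLpNorm P.B 2 (volume.restrict (Ioc 0 P.T))).toReal) ^ 2 / δ
      have hp : 0 < p := by positivity
      have h4 : γ ^ 2 * ((1 - 2 * κ * c) * ‖ζ‖ ^ 2) ≤ ‖R ζ‖ ^ 2 := by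
        have hk : 0 ≤ κ * c := by positivity
        -- The elementary bound `1 - 2s ≤ (1 + s)⁻²` linearizes the observability loss. If `1 - 2 κ
        -- c ≤ 0`, the estimate is trivial.
        have h5 : (1 - 2 * κ * c) * (1 + κ * c) ^ 2 ≤ 1 := by
          nlinarith [pow_nonneg hk 2, pow_nonneg hk 3]
        rcases le_or_gt (1 - 2 * κ * c) 0 with hs | hs
        · exact (mul_nonpos_of_nonneg_of_nonpos (sq_nonneg γ)
            (mul_nonpos_of_nonpos_of_nonneg hs (sq_nonneg _))).trans (sq_nonneg _)
        · calc γ ^ 2 * ((1 - 2 * κ * c) * ‖ζ‖ ^ 2) = (1 - 2 * κ * c) * (γ ^ 2 * ‖ζ‖ ^ 2) := by ring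
            _ ≤ (1 - 2 * κ * c) * ((1 + κ * c) ^ 2 * ‖R ζ‖ ^ 2) := by gcongr
            _ = (1 - 2 * κ * c) * (1 + κ * c) ^ 2 * ‖R ζ‖ ^ 2 := by ring
            _ ≤ 1 * ‖R ζ‖ ^ 2 := by gcongr
            _ = ‖R ζ‖ ^ 2 := one_mul _
      have h0 : 0 ≤ RCLike.re ⟪ζ, reducedHessian R Q P.U₀ ζ⟫_𝕜 :=
        nonneg_of_mul_nonneg_right ((sq_nonneg _).trans h1) hp
      rcases le_or_gt (1 - 2 * κ * c) 0 with hs | hs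
      · exact (mul_nonpos_of_nonpos_of_nonneg (mul_nonpos_of_nonneg_of_nonpos hα0.le hs)
          (sq_nonneg _)).trans (by positivity)
      · refine le_of_mul_le_mul_right ?_ hp
        calc α * (1 - 2 * κ * c) * ‖ζ‖ ^ 2 * p = α * p * ((1 - 2 * κ * c) * ‖ζ‖ ^ 2) := by ring
          _ ≤ 2 * γ ^ 2 * ((1 - 2 * κ * c) * ‖ζ‖ ^ 2) := by gcongr
          _ = 2 * (γ ^ 2 * ((1 - 2 * κ * c) * ‖ζ‖ ^ 2)) := by ring
          _ ≤ 2 * (p * RCLike.re ⟪ζ, reducedHessian R Q P.U₀ ζ⟫_𝕜) := by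
            exact mul_le_mul_of_nonneg_left (h4.trans h1) zero_le_two
          _ = _ := by ring
    have hcontr : ∀ ζ : X, ‖gradStep R Q P.U₀ h θ₀ κ ζ - ζo‖ ≤
        (1 - α * κ + M * κ ^ 2) * ‖ζ - ζo‖ := by
      intro ζ
      have hRn : ‖R‖ ^ 2 ≤ c := by
        calc ‖R‖ ^ 2 ≤ (‖P.C‖ * √P.T) ^ 2 := by
              gcongr; exact Problem.norm_closedStateOp_le hiso hκ.le
          _ = c := by rw [mul_pow, Real.sq_sqrt hT.le, mul_comm]
      have h1 := norm_sub_smul_reducedHessian_le hδ hUδ hκ hRn (ζ - ζo) (hrate (ζ - ζo))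
      rw [← gradStep_sub (h := h) (θ₀ := θ₀), hfix] at h1
      refine h1.trans_eq ?_
      rw [hM]
      ring
    refine ⟨fun ζ => ?_, fun z ϑ hz => ?_⟩
    · have := hcontr (ζ + ζo)
      rwa [add_sub_cancel_right] at this
    · have hzt : Tendsto z atTop (𝓝 ζo) := by
        refine tendsto_of_norm_sub_le (hlt κ hκ hκ') fun j => ?_
        rw [(hiter.1 (hz j)).1]
        exact hcontr (z j)
      -- Only `ϑ (j + 1)` is optimal, namely for `z j`; the starting parameter is arbitrary, hence
      -- the index shift.
      refine ⟨hzt, (tendsto_add_atTop_iff_nat 1).1 ?_⟩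
      have hcont : Continuous (optimalParam R Q P.U₀ h θ₀) := by
        unfold optimalParam
        fun_prop
      refine ((hcont.tendsto ζo).comp hzt).congr fun j => ?_
      exact (hiter.1 (hz j)).2.symm
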